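/- **Setting.** Let $N,n,m$ be non-negative integers, let $(\Omega,\mathfrak F,\mathbb P)$ be a probability space, $\mathfrak F_{-1}\subset\mathfrak F$ an initial $\sigma$-algebra (it carries the initial randomness) and $\omega_0,\omega_1,\dots$ real random variables; put $\mathfrak F_k=\mathfrak F_{-1}\vee\sigma(\omega_0,\dots,\omega_k)$. Assume that $\omega_0,\dots,\omega_{N-1}$ are square integrable with $\mathbb E[\omega_k\mid\mathfrak F_{k-1}]=0$ and $\mathbb E[\omega_k^2\mid\mathfrak F_{k-1}]=1$ for $0\le k<N$, and that $\mathfrak F_{-1}$ contains an event of probability strictly between $0$ and $1$ (so that non-constant initial states exist). Let $A_k,\bar A_k,C_k,\bar C_k\in\mathbb R^{n\times n}$, $B_k,\bar B_k,D_k,\bar D_k,S_k,\bar S_k\in\mathbb R^{n\times m}$, symmetric $Q_k,\bar Q_k,G,\bar G\in\mathbb R^{n\times n}$ and symmetric $R_k,\bar R_k\in\mathbb R^{m\times m}$ be deterministic; a prime denotes the transpose. For $0\le l<N$ and $\xi\in L^2(\mathfrak F_{l-1};\mathbb R^n)$, an admissible control on $\{l,\dots,N-1\}$ is a family $u=(u_l,\dots,u_{N-1})$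 with $u_k\in L^2(\mathfrak F_{k-1};\mathbb R^m)$. The state is given by $x_l=\xi$ and $$x_{k+1}=A_kx_k+\bar A_k\mathbb Ex_k+B_ku_k+\bar B_k\mathbb Eu_k+(C_kx_k+\bar C_k\mathbb Ex_k+D_ku_k+\bar D_k\mathbb Eu_k)\,\omega_k ,\qquad l\le k<N,$$ and the cost by $$J^0(l,\xi;u)=\mathbb E\Big\{x_N'Gx_N+(\mathbb Ex_N)'\bar G\,\mathbb Ex_N+\sum_{k=l}^{N-1}\big[x_k'Q_kx_k+2x_k'S_ku_k+u_k'R_ku_k+(\mathbb Ex_k)'\bar Q_k\mathbb Ex_k+2(\mathbb Ex_k)'\bar S_k\mathbb Eu_k+(\mathbb Eu_k)'\bar R_k\mathbb Eu_k\big]\Big\}$$ (for $N=0$ the cost $J^0(0,0;\cdot)$ is given by the same formula, with empty sum). Problem (MF-LQ)$^0$ is to minimize $J^0(l,\xi;\cdot)$. It is *closed-loop solvable* if there are deterministic $\Theta_k,\bar\Theta_k\in\mathbb R^{m\times n}$, $v_k\in\mathbb R^m$ ($0\le k<N$), depending neither on $l$ nor on $\xi$, such that for all $0\le l<N$ and all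 $\xi\in L^2(\mathfrak F_{l-1};\mathbb R^n)$ the following holds: if $x^*$ is the state with $x^*_l=\xi$ under the feedback $u^*_k=\Theta_kx^*_k+\bar\Theta_k\mathbb Ex^*_k+v_k$, then $u^*$ is admissible and $J^0(l,\xi;u^*)\le J^0(l,\xi;u)$ for every admissible $u$. For symmetric matrices $P_k,\Pi_k\in\mathbb R^{n\times n}$ write $$\Upsilon_k=R_k+B_k'P_{k+1}B_k+D_k'P_{k+1}D_k,\qquad H_k=B_k'P_{k+1}A_k+D_k'P_{k+1}C_k+S_k',$$ $$\bar\Upsilon_k=R_k+\bar R_k+(B_k+\bar B_k)'\Pi_{k+1}(B_k+\bar B_k)+(D_k+\bar D_k)'P_{k+1}(D_k+\bar D_k),$$ $$\bar H_k=(B_k+\bar B_k)'\Pi_{k+1}(A_k+\bar A_k)+(D_k+\bar D_k)'P_{k+1}(C_k+\bar C_k)+S_k'+\bar S_k'.$$ With $\dagger$ the Moore–Penrose inverse, the generalized Riccati equation (GRE) is, for $0\le k<N$, $$P_k=Q_k+A_k'P_{k+1}A_k+C_k'P_{k+1}C_k-H_k'\Upsilon_k^\dagger H_k,\qquad P_N=G,$$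 $$\Pi_k=Q_k+\bar Q_k+(A_k+\bar A_k)'\Pi_{k+1}(A_k+\bar A_k)+(C_k+\bar C_k)'P_{k+1}(C_k+\bar C_k)-\bar H_k'\bar\Upsilon_k^\dagger\bar H_k,\qquad \Pi_N=G+\bar G.$$ A solution is *regular* if $\Upsilon_k\ge0$, $\bar\Upsilon_k\ge0$, $\mathcal R(H_k)\subseteq\mathcal R(\Upsilon_k)$ and $\mathcal R(\bar H_k)\subseteq\mathcal R(\bar\Upsilon_k)$ for all $0\le k<N$, where $\mathcal R$ denotes the range; it is *strongly regular* if for some $\alpha>0$ we have $\Upsilon_k\ge\alpha I$ and $\bar\Upsilon_k\ge\alpha I$ for all $0\le k<N$. The GRE is *regularly solvable* if it has a regular solution. For $\varepsilon>0$ let GRE$^\varepsilon$ be the GRE with $R_k$ replaced by $R_k+\varepsilon I$, that is, the GRE of the cost $J^0(l,\xi;u)+\varepsilon\,\mathbb E\sum_{k=l}^{N-1}|u_k|^2$. If $(P^\varepsilon,\Pi^\varepsilon)$ is its (necessarily unique) strongly regular solution, and $\Upsilon^\varepsilon_k,H^\varepsilon_k,\bar\Upsilon^\varepsilon_k,\bar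 H^\varepsilon_k$ are the corresponding matrices, let $\Theta_k^\varepsilon=-(\Upsilon_k^\varepsilon)^{-1}H_k^\varepsilon$ and $\bar\Theta_k^\varepsilon=-(\bar\Upsilon_k^\varepsilon)^{-1}\bar H_k^\varepsilon$. Let $|M|^2=\mathrm{Tr}(M'M)$. **Theorem 6.4.** Assume that $u\mapsto J^0(0,0;u)$ is convex on the set of admissible controls on $\{0,\dots,N-1\}$, and that $$\sup_{\varepsilon>0}\ \sum_{k=0}^{N-1}\big(|\Theta_k^\varepsilon|^2+|\bar\Theta_k^\varepsilon|^2\big)<\infty ,$$ the supremum being over those $\varepsilon>0$ for which GRE$^\varepsilon$ has a strongly regular solution (existence for any $\varepsilon$ is not assumed). Then the GRE is regularly solvable and Problem (MF-LQ)$^0$ is closed-loop solvable. -/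

import Mathlib

open MeasureTheory Matrix

noncomputable section

/-! ### Moore-Penrose inverse -/

/-- The four Penrose equations: `X` is the Moore-Penrose inverse of the real matrix `M`. -/
def IsMoorePenrose {m : ℕ} (M X : Matrix (Fin m) (Fin m) ℝ) : Prop :=
  M * X * M = M ∧ X * M * X = X ∧ (M * X)ᵀ = M * X ∧ (X * M)ᵀ = X * M

theorem IsMoorePenrose.unique {m : ℕ} {M X Y : Matrix (Fin m) (Fin m) ℝ}
    (hX : IsMoorePenrose M X) (hY : IsMoorePenrose M Y) : X = Y := by
  obtain ⟨x1, x2, x3, x4⟩ := hX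
  obtain ⟨y1, y2, y3, y4⟩ := hY
  have e1 : M * X = M * Y := by
    calc M * X = (M * Y) * (M * X) := by rw [← Matrix.mul_assoc, y1]
      _ = (M * Y)ᵀ * (M * X)ᵀ := by rw [x3, y3]
      _ = ((M * X) * (M * Y))ᵀ := by rw [← Matrix.transpose_mul]
      _ = (M * Y)ᵀ := by rw [← Matrix.mul_assoc, x1]
      _ = M * Y := y3
  have e2 : X * M = Y * M := by
    calc X * M = (X * M) * (Y * M) := by
          rw [Matrix.mul_assoc, ← Matrix.mul_assoc M, y1]
      _ = (X * M)ᵀ * (Y * M)ᵀ := by rw [x4, y4]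
      _ = ((Y * M) * (X * M))ᵀ := by rw [← Matrix.transpose_mul]
      _ = (Y * M)ᵀ := by rw [Matrix.mul_assoc, ← Matrix.mul_assoc M, x1]
      _ = Y * M := y4
  calc X = X * M * X := x2.symm
    _ = Y * (M * X) := by rw [e2, Matrix.mul_assoc]
    _ = Y * M * Y := by rw [e1, Matrix.mul_assoc]
    _ = Y := y2

theorem exists_isMoorePenrose {m : ℕ} (M : Matrix (Fin m) (Fin m) ℝ) :
    ∃ X, IsMoorePenrose M X := by
  have hS : (Mᵀ * M).IsHermitian := by
    simpa using Matrix.isHermitian_conjTranspose_mul_self M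
  obtain ⟨Y, h1, h2, h3, h4⟩ : ∃ Y, (Mᵀ * M) * Y * (Mᵀ * M) = Mᵀ * M ∧
      Y * (Mᵀ * M) * Y = Y ∧ Yᵀ = Y ∧ (Y * (Mᵀ * M))ᵀ = Y * (Mᵀ * M) := by
    generalize Mᵀ * M = S at hS ⊢
    obtain ⟨φ, d, key⟩ : ∃ (φ : Matrix (Fin m) (Fin m) ℝ ≃⋆ₐ[ℝ] Matrix (Fin m) (Fin m) ℝ)
        (d : Fin m → ℝ), S = φ (diagonal d) := ⟨_, _, hS.spectral_theorem⟩
    have tr : ∀ d : Fin m → ℝ, (φ (diagonal d))ᵀ = φ (diagonal d) := by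
      intro d
      have : star (φ (diagonal d)) = φ (diagonal d) := by
        rw [← map_star]
        congr 1
        simp [Matrix.star_eq_conjTranspose]
      rwa [Matrix.star_eq_conjTranspose, Matrix.conjTranspose_eq_transpose_of_trivial] at this
    refine ⟨φ (diagonal fun i => (d i)⁻¹), ?_, ?_, tr _, ?_⟩
    · rw [key, ← map_mul, ← map_mul, diagonal_mul_diagonal, diagonal_mul_diagonal]
      simp
    · rw [key, ← map_mul, ← map_mul, diagonal_mul_diagonal, diagonal_mul_diagonal]
      congr 2
      funext i
      by_cases h : d i = 0 <;> simp [h]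
    · rw [key, ← map_mul, diagonal_mul_diagonal]
      exact tr _
  refine ⟨Y * Mᵀ, ?_, ?_, ?_, ?_⟩
  · have h0 : Mᵀ * M * (Y * (Mᵀ * M) - 1) = 0 := by
      rw [Matrix.mul_sub, Matrix.mul_one, ← Matrix.mul_assoc, h1, sub_self]
    have h5 : M * (Y * (Mᵀ * M) - 1) = 0 := by
      have := (Matrix.conjTranspose_mul_self_mul_eq_zero M (Y * (Mᵀ * M) - 1)).1
      rw [Matrix.conjTranspose_eq_transpose_of_trivial] at this
      exact this h0
    rw [Matrix.mul_sub, Matrix.mul_one, sub_eq_zero] at h5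
    simpa [Matrix.mul_assoc] using h5
  · calc Y * Mᵀ * M * (Y * Mᵀ) = (Y * (Mᵀ * M) * Y) * Mᵀ := by simp only [Matrix.mul_assoc]
      _ = Y * Mᵀ := by rw [h2]
  · simp [Matrix.transpose_mul, h3, Matrix.mul_assoc]
  · rw [Matrix.mul_assoc]
    exact h4

/-- The Moore-Penrose inverse `M†` of a real square matrix. -/
def pinv {m : ℕ} (M : Matrix (Fin m) (Fin m) ℝ) : Matrix (Fin m) (Fin m) ℝ :=
  (exists_isMoorePenrose M).choose

theorem pinv_spec {m : ℕ} (M : Matrix (Fin m) (Fin m) ℝ) : IsMoorePenrose M (pinv M) :=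
  (exists_isMoorePenrose M).choose_spec

/-- The squared Frobenius norm `|M|² = Tr(M'M)`. -/
def frobSq {m n : ℕ} (M : Matrix (Fin m) (Fin n) ℝ) : ℝ := (Mᵀ * M).trace

/-! ### Data of the homogeneous mean-field linear-quadratic problem -/

/-- Horizon, dynamics and cost coefficients (deterministic) of the homogeneous problem with state
space `ℝⁿ` and control space `ℝᵐ`. A final `b` stands for a bar. Only the coefficients with index
`k < N` play a role. The cross weights `S k`, `Sb k` are `n × m`: they enter the cost as
`2 x'S u` and `2 (𝔼x)' Sb (𝔼u)`. -/
structure MFLQ (n m : ℕ) where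
  N : ℕ
  A : ℕ → Matrix (Fin n) (Fin n) ℝ
  Ab : ℕ → Matrix (Fin n) (Fin n) ℝ
  B : ℕ → Matrix (Fin n) (Fin m) ℝ
  Bb : ℕ → Matrix (Fin n) (Fin m) ℝ
  C : ℕ → Matrix (Fin n) (Fin n) ℝ
  Cb : ℕ → Matrix (Fin n) (Fin n) ℝ
  D : ℕ → Matrix (Fin n) (Fin m) ℝ
  Db : ℕ → Matrix (Fin n) (Fin m) ℝ
  Q : ℕ → Matrix (Fin n) (Fin n) ℝ
  Qb : ℕ → Matrix (Fin n) (Fin n) ℝ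
  S : ℕ → Matrix (Fin n) (Fin m) ℝ
  Sb : ℕ → Matrix (Fin n) (Fin m) ℝ
  R : ℕ → Matrix (Fin m) (Fin m) ℝ
  Rb : ℕ → Matrix (Fin m) (Fin m) ℝ
  G : Matrix (Fin n) (Fin n) ℝ
  Gb : Matrix (Fin n) (Fin n) ℝ
  Q_symm : ∀ k, (Q k)ᵀ = Q k
  Qb_symm : ∀ k, (Qb k)ᵀ = Qb k
  R_symm : ∀ k, (R k)ᵀ = R k
  Rb_symm : ∀ k, (Rb k)ᵀ = Rb k
  G_symm : Gᵀ = G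
  Gb_symm : Gbᵀ = Gb

namespace MFLQ

variable {n m : ℕ}

/-- The regularized problem, whose cost is `J⁰ + ε 𝔼 ∑ |u_k|²`: `R k` becomes `R k + ε I`. -/
def reg (p : MFLQ n m) (ε : ℝ) : MFLQ n m :=
  { p with
    R := fun k => p.R k + ε • (1 : Matrix (Fin m) (Fin m) ℝ)
    R_symm := fun k => by simp [p.R_symm k] }

/-! ### Generalized Riccati equations -/

/-- `Υ_k = R_k + B_k' P_{k+1} B_k + D_k' P_{k+1} D_k`; the argument `P1` stands for `P_{k+1}`. -/
def ups (p : MFLQ n m) (k : ℕ) (P1 : Matrix (Fin n) (Fin n) ℝ) : Matrix (Fin m) (Fin m) ℝ :=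
  p.R k + (p.B k)ᵀ * P1 * p.B k + (p.D k)ᵀ * P1 * p.D k

/-- `H_k = B_k' P_{k+1} A_k + D_k' P_{k+1} C_k + S_k'`. -/
def hh (p : MFLQ n m) (k : ℕ) (P1 : Matrix (Fin n) (Fin n) ℝ) : Matrix (Fin m) (Fin n) ℝ :=
  (p.B k)ᵀ * P1 * p.A k + (p.D k)ᵀ * P1 * p.C k + (p.S k)ᵀ

/-- `Ῡ_k`, the mean-field counterpart of `Υ_k`; `Pi1` stands for `Π_{k+1}`. -/
def upsBar (p : MFLQ n m) (k : ℕ) (P1 Pi1 : Matrix (Fin n) (Fin n) ℝ) :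
    Matrix (Fin m) (Fin m) ℝ :=
  p.R k + p.Rb k + (p.B k + p.Bb k)ᵀ * Pi1 * (p.B k + p.Bb k)
    + (p.D k + p.Db k)ᵀ * P1 * (p.D k + p.Db k)

/-- `H̄_k`, the mean-field counterpart of `H_k`. -/
def hhBar (p : MFLQ n m) (k : ℕ) (P1 Pi1 : Matrix (Fin n) (Fin n) ℝ) :
    Matrix (Fin m) (Fin n) ℝ :=
  (p.B k + p.Bb k)ᵀ * Pi1 * (p.A k + p.Ab k) + (p.D k + p.Db k)ᵀ * P1 * (p.C k + p.Cb k)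
    + (p.S k)ᵀ + (p.Sb k)ᵀ

/-- `(P_k, Π_k)`, `0 ≤ k ≤ N`, solves the generalized Riccati equation (GRE). -/
def IsGRESolution (p : MFLQ n m) (P Pi : ℕ → Matrix (Fin n) (Fin n) ℝ) : Prop :=
  P p.N = p.G ∧ Pi p.N = p.G + p.Gb ∧ ∀ k < p.N,
    P k = p.Q k + (p.A k)ᵀ * P (k + 1) * p.A k + (p.C k)ᵀ * P (k + 1) * p.C k
        - (p.hh k (P (k + 1)))ᵀ * pinv (p.ups k (P (k + 1))) * p.hh k (P (k + 1)) ∧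
    Pi k = p.Q k + p.Qb k
        + (p.A k + p.Ab k)ᵀ * Pi (k + 1) * (p.A k + p.Ab k)
        + (p.C k + p.Cb k)ᵀ * P (k + 1) * (p.C k + p.Cb k)
        - (p.hhBar k (P (k + 1)) (Pi (k + 1)))ᵀ * pinv (p.upsBar k (P (k + 1)) (Pi (k + 1)))
          * p.hhBar k (P (k + 1)) (Pi (k + 1))

/-- Regular solution: `Υ_k, Ῡ_k ≥ 0` and the two range inclusions. (The square summability over
`k < N` of the finitely many matrices `Υ_k† H_k`, `Ῡ_k† H̄_k` is automatic.) -/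
def IsRegular (p : MFLQ n m) (P Pi : ℕ → Matrix (Fin n) (Fin n) ℝ) : Prop :=
  p.IsGRESolution P Pi ∧ ∀ k < p.N,
    (p.ups k (P (k + 1))).PosSemidef ∧
    (p.upsBar k (P (k + 1)) (Pi (k + 1))).PosSemidef ∧
    LinearMap.range (p.hh k (P (k + 1))).mulVecLin
      ≤ LinearMap.range (p.ups k (P (k + 1))).mulVecLin ∧
    LinearMap.range (p.hhBar k (P (k + 1)) (Pi (k + 1))).mulVecLin
      ≤ LinearMap.range (p.upsBar k (P (k + 1)) (Pi (k + 1))).mulVecLin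

/-- Strongly regular solution: `Υ_k, Ῡ_k ≥ α I` for some `α > 0`. -/
def IsStronglyRegular (p : MFLQ n m) (P Pi : ℕ → Matrix (Fin n) (Fin n) ℝ) : Prop :=
  p.IsGRESolution P Pi ∧ ∃ α : ℝ, 0 < α ∧ ∀ k < p.N,
    (p.ups k (P (k + 1)) - α • (1 : Matrix (Fin m) (Fin m) ℝ)).PosSemidef ∧
    (p.upsBar k (P (k + 1)) (Pi (k + 1)) - α • (1 : Matrix (Fin m) (Fin m) ℝ)).PosSemidef

/-- The GRE is regularly solvable. -/
def RegularlySolvable (p : MFLQ n m) : Prop := ∃ P Pi, p.IsRegular P Pi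

/-- The feedback gain `Θ_k = -Υ_k⁻¹ H_k` (used for invertible `Υ_k`). -/
def gain (p : MFLQ n m) (P : ℕ → Matrix (Fin n) (Fin n) ℝ) (k : ℕ) :
    Matrix (Fin m) (Fin n) ℝ :=
  -((p.ups k (P (k + 1)))⁻¹ * p.hh k (P (k + 1)))

/-- The feedback gain `Θ̄_k = -Ῡ_k⁻¹ H̄_k` (used for invertible `Ῡ_k`). -/
def gainBar (p : MFLQ n m) (P Pi : ℕ → Matrix (Fin n) (Fin n) ℝ) (k : ℕ) :
    Matrix (Fin m) (Fin n) ℝ :=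
  -((p.upsBar k (P (k + 1)) (Pi (k + 1)))⁻¹ * p.hhBar k (P (k + 1)) (Pi (k + 1)))

/-- `sup_{ε > 0} ∑_{k < N} (|Θ_k^ε|² + |Θ̄_k^ε|²) < ∞`, the gains being those of the strongly
regular solution of the GRE of the `ε`-regularized problem. No existence is asserted here. -/
def RegularizedGainsBounded (p : MFLQ n m) : Prop :=
  ∃ M : ℝ, ∀ ε : ℝ, 0 < ε → ∀ P Pi, (p.reg ε).IsStronglyRegular P Pi →
    ∑ k ∈ Finset.range p.N,
      (frobSq ((p.reg ε).gain P k) + frobSq ((p.reg ε).gainBar P Pi k)) ≤ M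

end MFLQ

/-! ### The stochastic control problem -/

/-- Information available when the control `u_k` is chosen: the initial `σ`-algebra `𝓖` together
with the noises `w_0, …, w_{k-1}`. -/
abbrev info {Ω : Type*} (𝓖 : MeasurableSpace Ω) (w : ℕ → Ω → ℝ) (k : ℕ) : MeasurableSpace Ω :=
  𝓖 ⊔ ⨆ j ∈ Finset.range k, MeasurableSpace.comap (w j) inferInstance

/-- `w_0, …, w_{N-1}` is a martingale difference sequence with conditional variance one. -/
structure IsNoise {Ω : Type*} (𝓖 : MeasurableSpace Ω) [mΩ : MeasurableSpace Ω] (μ : Measure Ω)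
    (w : ℕ → Ω → ℝ) (N : ℕ) : Prop where
  le : 𝓖 ≤ mΩ
  meas : ∀ k, Measurable (w k)
  memLp : ∀ k < N, MemLp (w k) 2 μ
  condExp_zero : ∀ k < N, μ[w k | info 𝓖 w k] =ᵐ[μ] fun _ => 0
  condExp_sq : ∀ k < N, μ[fun x => w k x ^ 2 | info 𝓖 w k] =ᵐ[μ] fun _ => 1

/-- The initial `σ`-algebra contains an event of probability strictly between `0` and `1`, that is,
it carries a non-constant square integrable random variable. -/
def NondegenerateInitial {Ω : Type*} (𝓖 : MeasurableSpace Ω) [MeasurableSpace Ω]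
    (μ : Measure Ω) : Prop :=
  ∃ s, MeasurableSet[𝓖] s ∧ 0 < μ s ∧ μ s < 1

namespace MFLQ

variable {n m : ℕ} {Ω : Type*}

/-- One step of the state equation: from `x = x_k`, `u = u_k` to `x_{k+1}`. -/
def step (p : MFLQ n m) [MeasurableSpace Ω] (μ : Measure Ω) (w : ℕ → Ω → ℝ) (k : ℕ)
    (x : Ω → Fin n → ℝ) (u : Ω → Fin m → ℝ) : Ω → Fin n → ℝ := fun z =>
  p.A k *ᵥ x z + p.Ab k *ᵥ (∫ y, x y ∂μ) + p.B k *ᵥ u z + p.Bb k *ᵥ (∫ y, u y ∂μ)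
    + w k z • (p.C k *ᵥ x z + p.Cb k *ᵥ (∫ y, x y ∂μ)
        + p.D k *ᵥ u z + p.Db k *ᵥ (∫ y, u y ∂μ))

/-- The state process with `x_l = ξ` under the control `u` (equal to `ξ` for `k ≤ l`). -/
def state (p : MFLQ n m) [MeasurableSpace Ω] (μ : Measure Ω) (w : ℕ → Ω → ℝ) (l : ℕ) (ξ : Ω → Fin n → ℝ)
    (u : ℕ → Ω → Fin m → ℝ) : ℕ → Ω → Fin n → ℝ
  | 0 => ξ
  | k + 1 => if k < l then ξ else p.step μ w k (p.state μ w l ξ u k) (u k)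

/-- Admissible controls on `{l, …, N-1}`. -/
def admissible (m : ℕ) (𝓖 : MeasurableSpace Ω) [MeasurableSpace Ω] (μ : Measure Ω)
    (w : ℕ → Ω → ℝ) (l N : ℕ) :
    Set (ℕ → Ω → Fin m → ℝ) :=
  {u | ∀ k, l ≤ k → k < N → Measurable[info 𝓖 w k] (u k) ∧ MemLp (u k) 2 μ}

/-- The homogeneous cost functional `J⁰(l, ξ; u)`. -/
def cost (p : MFLQ n m) [MeasurableSpace Ω] (μ : Measure Ω) (w : ℕ → Ω → ℝ) (l : ℕ) (ξ : Ω → Fin n → ℝ)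
    (u : ℕ → Ω → Fin m → ℝ) : ℝ :=
  let x := p.state μ w l ξ u
  let Ex : ℕ → Fin n → ℝ := fun k => ∫ y, x k y ∂μ
  let Eu : ℕ → Fin m → ℝ := fun k => ∫ y, u k y ∂μ
  ∫ z, (x p.N z ⬝ᵥ p.G *ᵥ x p.N z + Ex p.N ⬝ᵥ p.Gb *ᵥ Ex p.N
    + ∑ k ∈ Finset.Ico l p.N,
        (x k z ⬝ᵥ p.Q k *ᵥ x k z + 2 * (x k z ⬝ᵥ p.S k *ᵥ u k z) + u k z ⬝ᵥ p.R k *ᵥ u k z)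
    + ∑ k ∈ Finset.Ico l p.N,
        (Ex k ⬝ᵥ p.Qb k *ᵥ Ex k + 2 * (Ex k ⬝ᵥ p.Sb k *ᵥ Eu k) + Eu k ⬝ᵥ p.Rb k *ᵥ Eu k)) ∂μ

/-- The feedback control `Θ_k x + Θ̄_k 𝔼x + v_k` evaluated at a random state `x`. -/
def feedback [MeasurableSpace Ω] (μ : Measure Ω) (Θ Θb : ℕ → Matrix (Fin m) (Fin n) ℝ) (v : ℕ → Fin m → ℝ) (k : ℕ)
    (x : Ω → Fin n → ℝ) : Ω → Fin m → ℝ := fun z =>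
  Θ k *ᵥ x z + Θb k *ᵥ (∫ y, x y ∂μ) + v k

/-- The closed-loop state `x*` with `x*_l = ξ` under the strategy `(Θ, Θ̄, v)`. -/
def closedLoopState (p : MFLQ n m) [MeasurableSpace Ω] (μ : Measure Ω) (w : ℕ → Ω → ℝ) (l : ℕ) (ξ : Ω → Fin n → ℝ)
    (Θ Θb : ℕ → Matrix (Fin m) (Fin n) ℝ) (v : ℕ → Fin m → ℝ) : ℕ → Ω → Fin n → ℝ
  | 0 => ξ
  | k + 1 => if k < l then ξ else
      let x := p.closedLoopState μ w l ξ Θ Θb v k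
      p.step μ w k x (feedback μ Θ Θb v k x)

/-- The deterministic triple `(Θ, Θ̄, v)` is a closed-loop optimal strategy on `{l, …, N-1}`: for
every square integrable initial state `ξ` (known at time `l`) its outcome is an admissible control
that is at least as good as any other admissible control. -/
def IsClosedLoopOptimal (p : MFLQ n m) (𝓖 : MeasurableSpace Ω) [MeasurableSpace Ω] (μ : Measure Ω)
    (w : ℕ → Ω → ℝ)
    (l : ℕ) (Θ Θb : ℕ → Matrix (Fin m) (Fin n) ℝ) (v : ℕ → Fin m → ℝ) : Prop :=
  ∀ ξ : Ω → Fin n → ℝ, Measurable[info 𝓖 w l] ξ → MemLp ξ 2 μ →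
    let u' : ℕ → Ω → Fin m → ℝ := fun k =>
      feedback μ Θ Θb v k (p.closedLoopState μ w l ξ Θ Θb v k)
    u' ∈ admissible m 𝓖 μ w l p.N ∧
    ∀ u ∈ admissible m 𝓖 μ w l p.N, p.cost μ w l ξ u' ≤ p.cost μ w l ξ u

/-- The homogeneous problem is closed-loop solvable: there is a strategy, depending neither on the
initial time nor on the initial state, that is closed-loop optimal on `{l, …, N-1}` for each
`l < N`. -/
def ClosedLoopSolvable (p : MFLQ n m) (𝓖 : MeasurableSpace Ω) [MeasurableSpace Ω] (μ : Measure Ω)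
    (w : ℕ → Ω → ℝ) :
    Prop :=
  ∃ (Θ Θb : ℕ → Matrix (Fin m) (Fin n) ℝ) (v : ℕ → Fin m → ℝ),
    ∀ l < p.N, p.IsClosedLoopOptimal 𝓖 μ w l Θ Θb v

end MFLQ

end

/-! ### Moore-Penrose inverses and quadratic forms -/

/-! The proof regularizes, then passes to the limit. Started from zero, the state is linear in the
control, so the cost is even and vanishes at `u = 0`; convexity therefore makes it nonnegative
(`cost_nonneg_of_convexOn`). Adding `ε 𝔼 ∑ |u_k|²` gives a cost bounded below by that same term.

Split each state and control into mean and fluctuation. One step of the dynamics then adds to the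
value `𝔼 (x - 𝔼x)' P (x - 𝔼x) + (𝔼x)' Π 𝔼x` and the running cost a quadratic form in the
fluctuations, with control weight `Υ`, and a separate one in the means, with control weight `Ῡ`
(`valueAt_step_add_stageCost`). Completing both squares and telescoping writes the cost as the
initial value plus penalties for deviating from the feedback (`IsTrajectory.valueAt_add_sum`).

The Riccati recursion with the Moore–Penrose inverse always has a solution; the issue is the sign of
`Υ` and `Ῡ`. Working backwards, start from zero, act only at time `k`, and use the feedback
afterwards: the cost is exactly the quadratic form of `Υ_k` and `Ῡ_k` in `u_k`. Coercivity, tested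
on centred and on constant `u_k`, bounds both matrices below
(`IsGRESolution.isStronglyRegular_of_coercive`). Hence every regularized equation is strongly
regularly solvable, and the bound on the gains applies for every `ε > 0`.

By compactness the gains converge along some `ε → 0`. The Moore–Penrose inverse is not continuous,
so the limit is taken in the gain form `Υ Θ = -H`, `P = lyap + H'Θ`, which is polynomial in `P`, `Π`
and the gains (`exists_isGainForm_of_tendsto`). In the limit `Υ Θ = -H` yields the range inclusions
and turns the gain form back into the Riccati equation. With `Υ, Ῡ ≥ 0` the penalties are
nonnegative and the limiting feedback makes them vanish, so it is optimal
(`isClosedLoopOptimal_of_isGainForm`). -/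

theorem pinv_transpose {m : ℕ} {M : Matrix (Fin m) (Fin m) ℝ} (hM : Mᵀ = M) :
    (pinv M)ᵀ = pinv M := by
  obtain ⟨h1, h2, h3, h4⟩ := pinv_spec M
  refine IsMoorePenrose.unique (M := M) ⟨?_, ?_, ?_, ?_⟩ (pinv_spec M)
  · simpa [hM, Matrix.mul_assoc] using congrArg transpose h1
  · simpa [hM, Matrix.mul_assoc] using congrArg transpose h2
  · simpa [hM] using h4.symm
  · simpa [hM] using h3.symm

theorem range_mulVecLin_le_of_mul_eq_neg {m n : ℕ} {M : Matrix (Fin m) (Fin m) ℝ}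
    {H Θ : Matrix (Fin m) (Fin n) ℝ} (h : M * Θ = -H) :
    LinearMap.range H.mulVecLin ≤ LinearMap.range M.mulVecLin := by
  rintro _ ⟨y, rfl⟩
  refine ⟨-(Θ *ᵥ y), ?_⟩
  simp [mulVec_neg, h, neg_mulVec]

/-- The Riccati correction term `H' M† H` in terms of a gain `Θ` with `M Θ = -H`. -/
theorem transpose_mul_pinv_mul_of_mul_eq_neg {m n : ℕ} {M : Matrix (Fin m) (Fin m) ℝ}
    (hM : Mᵀ = M) {H Θ : Matrix (Fin m) (Fin n) ℝ} (h : M * Θ = -H) :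
    Hᵀ * pinv M * H = -(Hᵀ * Θ) := by
  have hH : H = -(M * Θ) := by rw [h, neg_neg]
  have e : M * (pinv M * (M * Θ)) = M * Θ := by
    rw [← Matrix.mul_assoc, ← Matrix.mul_assoc, (pinv_spec M).1]
  rw [hH]
  simp only [transpose_neg, transpose_mul, hM, Matrix.neg_mul, Matrix.mul_neg, neg_neg,
    Matrix.mul_assoc, e]

theorem posSemidef_iff_forall {m : ℕ} {M : Matrix (Fin m) (Fin m) ℝ} :
    M.PosSemidef ↔ Mᵀ = M ∧ ∀ c, 0 ≤ c ⬝ᵥ M *ᵥ c := by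
  refine ⟨fun h => ⟨?_, fun c => ?_⟩, fun h => .of_dotProduct_mulVec_nonneg ?_ fun c => ?_⟩
  · simpa [IsHermitian, conjTranspose_eq_transpose_of_trivial] using h.isHermitian
  · simpa using h.dotProduct_mulVec_nonneg c
  · simpa [IsHermitian, conjTranspose_eq_transpose_of_trivial] using h.1
  · simpa using h.2 c

theorem isUnit_of_sub_smul_one_posSemidef {m : ℕ} {M : Matrix (Fin m) (Fin m) ℝ} {α : ℝ}
    (hα : 0 < α) (h : (M - α • (1 : Matrix (Fin m) (Fin m) ℝ)).PosSemidef) : IsUnit M := by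
  have h1 : (α • (1 : Matrix (Fin m) (Fin m) ℝ)).PosDef := PosDef.one.smul hα
  simpa using (h1.add_posSemidef h).isUnit

theorem dotProduct_mulVec_comm_of_symm {n : ℕ} {M : Matrix (Fin n) (Fin n) ℝ} (hM : Mᵀ = M)
    (x y : Fin n → ℝ) : x ⬝ᵥ M *ᵥ y = y ⬝ᵥ M *ᵥ x := by
  have := dotProduct_transpose_mulVec M x y
  rwa [hM] at this

/-- Two weights are allowed so that one identity serves twice: with `Pi = P` for the fluctuations,
and with the barred coefficients for the means, where drift and diffusion carry different weights.
-/
theorem quadratic_step {n m : ℕ} {A C Q P Pi : Matrix (Fin n) (Fin n) ℝ}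
    {B D S : Matrix (Fin n) (Fin m) ℝ} {R : Matrix (Fin m) (Fin m) ℝ}
    (hP : Pᵀ = P) (hPi : Piᵀ = Pi) (x : Fin n → ℝ) (u : Fin m → ℝ) :
    (A *ᵥ x + B *ᵥ u) ⬝ᵥ Pi *ᵥ (A *ᵥ x + B *ᵥ u) + (C *ᵥ x + D *ᵥ u) ⬝ᵥ P *ᵥ (C *ᵥ x + D *ᵥ u)
        + (x ⬝ᵥ Q *ᵥ x + 2 * (x ⬝ᵥ S *ᵥ u) + u ⬝ᵥ R *ᵥ u)
      = x ⬝ᵥ (Q + Aᵀ * Pi * A + Cᵀ * P * C) *ᵥ x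
        + 2 * (u ⬝ᵥ (Bᵀ * Pi * A + Dᵀ * P * C + Sᵀ) *ᵥ x)
        + u ⬝ᵥ (R + Bᵀ * Pi * B + Dᵀ * P * D) *ᵥ u := by
  have e1 := dotProduct_mulVec_comm_of_symm hPi (A *ᵥ x) (B *ᵥ u)
  have e2 := dotProduct_mulVec_comm_of_symm hP (C *ᵥ x) (D *ᵥ u)
  have tr : ∀ {i j : ℕ} (M : Matrix (Fin i) (Fin j) ℝ) (y : Fin j → ℝ) (z : Fin i → ℝ),
      y ⬝ᵥ Mᵀ *ᵥ z = (M *ᵥ y) ⬝ᵥ z := fun M y z => by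
    rw [dotProduct_transpose_mulVec, dotProduct_comm]
  simp only [mulVec_add, dotProduct_add, add_dotProduct, add_mulVec, ← mulVec_mulVec, tr]
  rw [e1, e2, dotProduct_comm (S *ᵥ u) x]
  ring

/-- The relation `Y * Θ = -H` turns the cross term into `-2 u'YΘx`; invertibility of `Y` plays no
role, so the identity survives the limit `ε → 0`. -/
theorem complete_square {n m : ℕ} {K : Matrix (Fin n) (Fin n) ℝ} {H Θ : Matrix (Fin m) (Fin n) ℝ}
    {Y : Matrix (Fin m) (Fin m) ℝ} (hY : Yᵀ = Y) (h : Y * Θ = -H) (x : Fin n → ℝ)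
    (u : Fin m → ℝ) :
    x ⬝ᵥ K *ᵥ x + 2 * (u ⬝ᵥ H *ᵥ x) + u ⬝ᵥ Y *ᵥ u
      = x ⬝ᵥ (K + Hᵀ * Θ) *ᵥ x + (u - Θ *ᵥ x) ⬝ᵥ Y *ᵥ (u - Θ *ᵥ x) := by
  have e := dotProduct_mulVec_comm_of_symm hY (Θ *ᵥ x) u
  have tr : x ⬝ᵥ Hᵀ *ᵥ (Θ *ᵥ x) = (Θ *ᵥ x) ⬝ᵥ H *ᵥ x := dotProduct_transpose_mulVec _ _ _
  have f : Y *ᵥ (Θ *ᵥ x) = -(H *ᵥ x) := by rw [mulVec_mulVec, h, neg_mulVec]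
  simp only [add_mulVec, dotProduct_add, ← mulVec_mulVec, tr, mulVec_sub, dotProduct_sub,
    sub_dotProduct, e, f, dotProduct_neg]
  ring

/-! ### Square integrable random vectors -/

section Moments

variable {Ω : Type*} {mΩ : MeasurableSpace Ω} {μ : Measure Ω} {i j : ℕ}

theorem MeasureTheory.MemLp.mulVec {x : Ω → Fin j → ℝ} (hx : MemLp x 2 μ)
    (M : Matrix (Fin i) (Fin j) ℝ) : MemLp (fun z => M *ᵥ x z) 2 μ :=
  hx.continuousLinearMap_comp (LinearMap.toContinuousLinearMap M.mulVecLin)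

theorem MeasureTheory.MemLp.integrable_dotProduct_mulVec {x : Ω → Fin i → ℝ} {y : Ω → Fin j → ℝ}
    (hx : MemLp x 2 μ) (hy : MemLp y 2 μ) (M : Matrix (Fin i) (Fin j) ℝ) :
    Integrable (fun z => x z ⬝ᵥ M *ᵥ y z) μ := by
  have h := memLp_pi_iff.1 (hy.mulVec M)
  have hx' := memLp_pi_iff.1 hx
  exact integrable_finsetSum _ fun a _ => (hx' a).integrable_mul (h a)

theorem integral_add_add_add {f₁ f₂ f₃ f₄ : Ω → ℝ} (h₁ : Integrable f₁ μ) (h₂ : Integrable f₂ μ)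
    (h₃ : Integrable f₃ μ) (h₄ : Integrable f₄ μ) :
    ∫ z, (f₁ z + f₂ z + f₃ z + f₄ z) ∂μ
      = ∫ z, f₁ z ∂μ + ∫ z, f₂ z ∂μ + ∫ z, f₃ z ∂μ + ∫ z, f₄ z ∂μ := by
  have h₁₂ : Integrable (fun z => f₁ z + f₂ z) μ := h₁.add h₂
  have h₁₂₃ : Integrable (fun z => f₁ z + f₂ z + f₃ z) μ := h₁₂.add h₃
  rw [integral_add h₁₂₃ h₄, integral_add h₁₂ h₃, integral_add h₁ h₂]

variable [IsProbabilityMeasure μ]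

theorem integral_mulVec {x : Ω → Fin j → ℝ} (hx : MemLp x 2 μ)
    (M : Matrix (Fin i) (Fin j) ℝ) : ∫ z, M *ᵥ x z ∂μ = M *ᵥ ∫ z, x z ∂μ :=
  (LinearMap.toContinuousLinearMap M.mulVecLin).integral_comp_comm
    (hx.integrable (by norm_num))

theorem integral_dotProduct_const {x : Ω → Fin j → ℝ} (hx : MemLp x 2 μ) (c : Fin j → ℝ) :
    ∫ z, x z ⬝ᵥ c ∂μ = (∫ z, x z ∂μ) ⬝ᵥ c := by
  have hi : ∀ a, Integrable (fun z => x z a) μ := fun a =>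
    (memLp_pi_iff.1 hx a).integrable (by norm_num)
  simp only [dotProduct]
  rw [integral_finsetSum _ fun a _ => (hi a).mul_const _]
  simp only [integral_mul_const, eval_integral hi]

theorem integral_sub_mean {x : Ω → Fin j → ℝ} (hx : MemLp x 2 μ) :
    ∫ z, (x z - ∫ y, x y ∂μ) ∂μ = 0 := by
  rw [integral_sub (hx.integrable (by norm_num)) (integrable_const _)]
  simp

theorem memLp_sub_mean {x : Ω → Fin j → ℝ} (hx : MemLp x 2 μ) :
    MemLp (fun z => x z - ∫ y, x y ∂μ) 2 μ :=
  hx.sub (memLp_const _)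

/-- The cross terms are linear in a centred variable, hence integrate to zero. -/
theorem integral_add_const_quadratic {x : Ω → Fin i → ℝ} {y : Ω → Fin j → ℝ}
    (hx : MemLp x 2 μ) (hy : MemLp y 2 μ) (hx0 : ∫ z, x z ∂μ = 0) (hy0 : ∫ z, y z ∂μ = 0)
    (a : Fin i → ℝ) (b : Fin j → ℝ) (M : Matrix (Fin i) (Fin j) ℝ) :
    ∫ z, (x z + a) ⬝ᵥ M *ᵥ (y z + b) ∂μ = ∫ z, x z ⬝ᵥ M *ᵥ y z ∂μ + a ⬝ᵥ M *ᵥ b := by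
  have h1 := hx.integrable_dotProduct_mulVec hy M
  have h2 := hx.integrable_dotProduct_mulVec (memLp_const b) M
  have h3 := (memLp_const a).integrable_dotProduct_mulVec hy M
  have e2 : ∫ z, x z ⬝ᵥ M *ᵥ b ∂μ = 0 := by
    rw [integral_dotProduct_const hx, hx0, zero_dotProduct]
  have e3 : ∫ z, a ⬝ᵥ M *ᵥ y z ∂μ = 0 := by
    simp_rw [dotProduct_comm a]
    rw [integral_dotProduct_const (hy.mulVec M), integral_mulVec hy, hy0, mulVec_zero,
      zero_dotProduct]
  have e : ∀ z, (x z + a) ⬝ᵥ M *ᵥ (y z + b)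
      = x z ⬝ᵥ M *ᵥ y z + x z ⬝ᵥ M *ᵥ b + a ⬝ᵥ M *ᵥ y z + a ⬝ᵥ M *ᵥ b := fun z => by
    simp only [mulVec_add, dotProduct_add, add_dotProduct]; ring
  simp_rw [e]
  rw [integral_add_add_add h1 h2 h3 (integrable_const _), e2, e3]
  simp

theorem integral_centered {x : Ω → Fin i → ℝ} {y : Ω → Fin j → ℝ}
    (hx : MemLp x 2 μ) (hy : MemLp y 2 μ) (M : Matrix (Fin i) (Fin j) ℝ) :
    ∫ z, x z ⬝ᵥ M *ᵥ y z ∂μ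
      = ∫ z, (x z - ∫ y, x y ∂μ) ⬝ᵥ M *ᵥ (y z - ∫ z, y z ∂μ) ∂μ
        + (∫ y, x y ∂μ) ⬝ᵥ M *ᵥ ∫ z, y z ∂μ := by
  rw [← integral_add_const_quadratic (memLp_sub_mean hx) (memLp_sub_mean hy)
    (integral_sub_mean hx) (integral_sub_mean hy)]
  simp

end Moments

/-! ### White noise -/

/-- `ω` is square integrable, with conditional mean zero and conditional variance one given
`𝓕`. -/
structure IsWhiteNoise {Ω : Type*} (𝓕 : MeasurableSpace Ω) {mΩ : MeasurableSpace Ω}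
    (μ : Measure Ω) (ω : Ω → ℝ) : Prop where
  le : 𝓕 ≤ mΩ
  meas : Measurable ω
  memLp : MemLp ω 2 μ
  condExp_zero : μ[ω | 𝓕] =ᵐ[μ] fun _ => 0
  condExp_sq : μ[fun z => ω z ^ 2 | 𝓕] =ᵐ[μ] fun _ => 1

section WhiteNoise

variable {Ω : Type*} {𝓕 : MeasurableSpace Ω} {mΩ : MeasurableSpace Ω} {μ : Measure Ω}
  [IsProbabilityMeasure μ] {ω : Ω → ℝ}

/-- Conditional variance one means precisely that the measure with density `ω²` agrees with `μ` on
`𝓕`. -/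
theorem IsWhiteNoise.trim_withDensity_sq (h : IsWhiteNoise 𝓕 μ ω) :
    (μ.withDensity fun z => ENNReal.ofReal (ω z ^ 2)).trim h.le = μ.trim h.le := by
  refine @Measure.ext Ω 𝓕 _ _ fun s hs => ?_
  have hi : Integrable (fun z => ω z ^ 2) μ := h.memLp.integrable_sq
  rw [trim_measurableSet_eq h.le hs, trim_measurableSet_eq h.le hs,
    withDensity_apply _ (h.le s hs),
    ← ofReal_integral_eq_lintegral_ofReal hi.integrableOn (.of_forall fun z => sq_nonneg _),
    ← setIntegral_condExp h.le hi hs,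
    setIntegral_congr_ae (h.le s hs) (h.condExp_sq.mono fun z hz _ => hz)]
  simp

/-- Integrability of `ω² f` is a conclusion here, whereas pulling `f` out of a conditional
expectation would presuppose it. Both claims transfer through the equality of the two measures on
`𝓕`. -/
theorem IsWhiteNoise.sq_mul (h : IsWhiteNoise 𝓕 μ ω) {f : Ω → ℝ} (hm : Measurable[𝓕] f)
    (hf : Integrable f μ) :
    Integrable (fun z => ω z ^ 2 * f z) μ ∧ ∫ z, ω z ^ 2 * f z ∂μ = ∫ z, f z ∂μ := by
  have hd : Measurable fun z => ENNReal.ofReal (ω z ^ 2) := (h.meas.pow_const 2).ennreal_ofReal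
  have hlt : ∀ᵐ z ∂μ, ENNReal.ofReal (ω z ^ 2) < ⊤ := .of_forall fun z => ENNReal.ofReal_lt_top
  have hs : StronglyMeasurable[𝓕] f := hm.stronglyMeasurable
  have e : ∀ z, ω z ^ 2 * f z = (ENNReal.ofReal (ω z ^ 2)).toReal • f z := fun z => by
    rw [ENNReal.toReal_ofReal (sq_nonneg _), smul_eq_mul]
  constructor
  · simp_rw [e]
    rw [← integrable_withDensity_iff_integrable_smul' hd hlt]
    refine integrable_of_integrable_trim h.le ?_
    rw [h.trim_withDensity_sq]
    exact hf.trim h.le hs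
  · simp_rw [e]
    rw [← integral_withDensity_eq_integral_toReal_smul hd hlt, integral_trim h.le hs,
      h.trim_withDensity_sq, ← integral_trim h.le hs]

theorem IsWhiteNoise.integral_mul_eq_zero (h : IsWhiteNoise 𝓕 μ ω) {f : Ω → ℝ}
    (hm : Measurable[𝓕] f) (hf : Integrable (fun z => f z * ω z) μ) :
    ∫ z, f z * ω z ∂μ = 0 := by
  have hs : StronglyMeasurable[𝓕] f := hm.stronglyMeasurable
  have e := condExp_mul_of_stronglyMeasurable_left hs hf (h.memLp.integrable (by norm_num))
  rw [← integral_condExp h.le]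
  have : μ[fun z => f z * ω z | 𝓕] =ᵐ[μ] fun _ => 0 := by
    refine e.trans (h.condExp_zero.mono fun z hz => ?_)
    simp [hz]
  rw [integral_congr_ae this, integral_zero]

variable {i j : ℕ}

theorem IsWhiteNoise.memLp_smul (h : IsWhiteNoise 𝓕 μ ω) {b : Ω → Fin j → ℝ}
    (hm : Measurable[𝓕] b) (hb : MemLp b 2 μ) : MemLp (fun z => ω z • b z) 2 μ := by
  have hs : AEStronglyMeasurable (fun z => ω z • b z) μ :=
    h.meas.aestronglyMeasurable.smul hb.aestronglyMeasurable
  rw [memLp_two_iff_integrable_sq_norm hs]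
  have := (h.sq_mul (f := fun z => ‖b z‖ ^ 2) ((measurable_norm.pow_const 2).comp hm) hb.integrable_norm_pow').1
  simpa [norm_smul, mul_pow] using this

theorem IsWhiteNoise.integral_smul_eq_zero (h : IsWhiteNoise 𝓕 μ ω) {b : Ω → Fin j → ℝ}
    (hm : Measurable[𝓕] b) (hb : MemLp b 2 μ) : ∫ z, ω z • b z ∂μ = 0 := by
  have hi := memLp_pi_iff.1 (h.memLp_smul hm hb)
  ext a
  rw [eval_integral fun a => (hi a).integrable (by norm_num)]
  have : Integrable (fun z => b z a * ω z) μ := by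
    simpa [mul_comm] using (hi a).integrable (by norm_num)
  simpa [mul_comm] using h.integral_mul_eq_zero (f := fun z => b z a)
    ((measurable_pi_apply a).comp hm) this

theorem measurable_dotProduct_mulVec {a : Ω → Fin i → ℝ} {b : Ω → Fin j → ℝ}
    (ha : Measurable[𝓕] a) (hb : Measurable[𝓕] b) (M : Matrix (Fin i) (Fin j) ℝ) :
    Measurable[𝓕] fun z => a z ⬝ᵥ M *ᵥ b z := by
  have : Continuous fun q : (Fin i → ℝ) × (Fin j → ℝ) => q.1 ⬝ᵥ M *ᵥ q.2 :=
    continuous_fst.dotProduct (continuous_const.matrix_mulVec continuous_snd)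
  exact this.measurable.comp (ha.prodMk hb)

/-- Terms linear in `ω` have `𝓕`-measurable coefficients and vanish; in the quadratic term `ω²`
integrates as `1`. -/
theorem IsWhiteNoise.integral_quadratic (h : IsWhiteNoise 𝓕 μ ω) {a b : Ω → Fin j → ℝ}
    (ham : Measurable[𝓕] a) (ha : MemLp a 2 μ) (hbm : Measurable[𝓕] b) (hb : MemLp b 2 μ)
    (M : Matrix (Fin j) (Fin j) ℝ) :
    ∫ z, (a z + ω z • b z) ⬝ᵥ M *ᵥ (a z + ω z • b z) ∂μ
      = ∫ z, a z ⬝ᵥ M *ᵥ a z ∂μ + ∫ z, b z ⬝ᵥ M *ᵥ b z ∂μ := by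
  have hwb := h.memLp_smul hbm hb
  have i1 := ha.integrable_dotProduct_mulVec ha M
  have i2 := ha.integrable_dotProduct_mulVec hwb M
  have i3 := hwb.integrable_dotProduct_mulVec ha M
  obtain ⟨i4, e4⟩ := h.sq_mul (measurable_dotProduct_mulVec hbm hbm M)
    (hb.integrable_dotProduct_mulVec hb M)
  have c2 : ∀ z, a z ⬝ᵥ M *ᵥ (ω z • b z) = (a z ⬝ᵥ M *ᵥ b z) * ω z := fun z => by
    rw [mulVec_smul, dotProduct_smul, smul_eq_mul, mul_comm]
  have c3 : ∀ z, (ω z • b z) ⬝ᵥ M *ᵥ a z = (b z ⬝ᵥ M *ᵥ a z) * ω z := fun z => by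
    rw [smul_dotProduct, smul_eq_mul, mul_comm]
  simp_rw [c2] at i2
  simp_rw [c3] at i3
  have e2 := h.integral_mul_eq_zero (measurable_dotProduct_mulVec ham hbm M) i2
  have e3 := h.integral_mul_eq_zero (measurable_dotProduct_mulVec hbm ham M) i3
  have e : ∀ z, (a z + ω z • b z) ⬝ᵥ M *ᵥ (a z + ω z • b z)
      = a z ⬝ᵥ M *ᵥ a z + (a z ⬝ᵥ M *ᵥ b z) * ω z + (b z ⬝ᵥ M *ᵥ a z) * ω z
        + ω z ^ 2 * (b z ⬝ᵥ M *ᵥ b z) := fun z => by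
    simp only [mulVec_add, dotProduct_add, add_dotProduct, mulVec_smul, dotProduct_smul,
      smul_dotProduct, smul_eq_mul]
    ring
  simp_rw [e]
  rw [integral_add_add_add i1 i2 i3 i4, e2, e3, e4]
  ring

end WhiteNoise

namespace MFLQ

/-! ### Cost-to-go along trajectories -/

section Riccati

variable {n m : ℕ}

/-- `Q_k + A_k' P_{k+1} A_k + C_k' P_{k+1} C_k`, the Riccati map without its correction term. -/
def lyap (p : MFLQ n m) (k : ℕ) (P1 : Matrix (Fin n) (Fin n) ℝ) : Matrix (Fin n) (Fin n) ℝ :=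
  p.Q k + (p.A k)ᵀ * P1 * p.A k + (p.C k)ᵀ * P1 * p.C k

/-- The mean-field counterpart of `lyap`. -/
def lyapBar (p : MFLQ n m) (k : ℕ) (P1 Pi1 : Matrix (Fin n) (Fin n) ℝ) :
    Matrix (Fin n) (Fin n) ℝ :=
  p.Q k + p.Qb k + (p.A k + p.Ab k)ᵀ * Pi1 * (p.A k + p.Ab k)
    + (p.C k + p.Cb k)ᵀ * P1 * (p.C k + p.Cb k)

/-- The Riccati equation at time `k`, written with gains `Θ`, `Θb` such that `Υ Θ = -H` and
`Ῡ Θb = -H̄`, so that no generalized inverse appears. -/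
structure IsGainForm (p : MFLQ n m) (P Pi : ℕ → Matrix (Fin n) (Fin n) ℝ)
    (Θ Θb : ℕ → Matrix (Fin m) (Fin n) ℝ) (k : ℕ) : Prop where
  symm : (P (k + 1))ᵀ = P (k + 1)
  symmBar : (Pi (k + 1))ᵀ = Pi (k + 1)
  gain : p.ups k (P (k + 1)) * Θ k = -p.hh k (P (k + 1))
  gainBar : p.upsBar k (P (k + 1)) (Pi (k + 1)) * Θb k = -p.hhBar k (P (k + 1)) (Pi (k + 1))
  eq : P k = p.lyap k (P (k + 1)) + (p.hh k (P (k + 1)))ᵀ * Θ k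
  eqBar : Pi k = p.lyapBar k (P (k + 1)) (Pi (k + 1))
    + (p.hhBar k (P (k + 1)) (Pi (k + 1)))ᵀ * Θb k

variable (p : MFLQ n m) (k : ℕ) {P1 Pi1 : Matrix (Fin n) (Fin n) ℝ}

theorem ups_transpose (h : P1ᵀ = P1) : (p.ups k P1)ᵀ = p.ups k P1 := by
  simp [ups, p.R_symm k, h, Matrix.mul_assoc]

theorem upsBar_transpose (h : P1ᵀ = P1) (h' : Pi1ᵀ = Pi1) :
    (p.upsBar k P1 Pi1)ᵀ = p.upsBar k P1 Pi1 := by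
  simp only [upsBar, transpose_add, transpose_mul, transpose_transpose, p.R_symm k, p.Rb_symm k,
    h, h', Matrix.mul_assoc]

theorem lyap_transpose (h : P1ᵀ = P1) : (p.lyap k P1)ᵀ = p.lyap k P1 := by
  simp [lyap, p.Q_symm k, h, Matrix.mul_assoc]

theorem lyapBar_transpose (h : P1ᵀ = P1) (h' : Pi1ᵀ = Pi1) :
    (p.lyapBar k P1 Pi1)ᵀ = p.lyapBar k P1 Pi1 := by
  simp only [lyapBar, transpose_add, transpose_mul, transpose_transpose, p.Q_symm k, p.Qb_symm k,
    h, h', Matrix.mul_assoc]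

end Riccati

/-! ### One-step identity for value and running cost -/

section Trajectory

variable {n m : ℕ} {Ω : Type*} {𝓕 : MeasurableSpace Ω} {mΩ : MeasurableSpace Ω} {μ : Measure Ω}

/-- The value `𝔼 (x - 𝔼x)' P (x - 𝔼x) + (𝔼x)' Π 𝔼x` of a random state. -/
noncomputable def valueAt (μ : Measure Ω) (P Pi : Matrix (Fin n) (Fin n) ℝ) (x : Ω → Fin n → ℝ) : ℝ :=
  ∫ z, (x z - ∫ y, x y ∂μ) ⬝ᵥ P *ᵥ (x z - ∫ y, x y ∂μ) ∂μ
    + (∫ y, x y ∂μ) ⬝ᵥ Pi *ᵥ ∫ y, x y ∂μ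

/-- The expected running cost at time `k`. -/
noncomputable def stageCost (p : MFLQ n m) (μ : Measure Ω) (k : ℕ) (x : Ω → Fin n → ℝ) (u : Ω → Fin m → ℝ) :
    ℝ :=
  ∫ z, (x z ⬝ᵥ p.Q k *ᵥ x z + 2 * (x z ⬝ᵥ p.S k *ᵥ u z) + u z ⬝ᵥ p.R k *ᵥ u z) ∂μ
    + ((∫ y, x y ∂μ) ⬝ᵥ p.Qb k *ᵥ (∫ y, x y ∂μ)
      + 2 * ((∫ y, x y ∂μ) ⬝ᵥ p.Sb k *ᵥ (∫ y, u y ∂μ))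
      + (∫ y, u y ∂μ) ⬝ᵥ p.Rb k *ᵥ (∫ y, u y ∂μ))

/-- The expected quadratic penalty for deviating from the feedback with gains `Θ`, `Θb`. -/
noncomputable def penalty (μ : Measure Ω) (Y Yb : Matrix (Fin m) (Fin m) ℝ) (Θ Θb : Matrix (Fin m) (Fin n) ℝ)
    (x : Ω → Fin n → ℝ) (u : Ω → Fin m → ℝ) : ℝ :=
  ∫ z, ((u z - ∫ y, u y ∂μ) - Θ *ᵥ (x z - ∫ y, x y ∂μ)) ⬝ᵥ
      Y *ᵥ ((u z - ∫ y, u y ∂μ) - Θ *ᵥ (x z - ∫ y, x y ∂μ)) ∂μ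
    + ((∫ y, u y ∂μ) - Θb *ᵥ ∫ y, x y ∂μ) ⬝ᵥ Yb *ᵥ ((∫ y, u y ∂μ) - Θb *ᵥ ∫ y, x y ∂μ)

theorem penalty_nonneg {Y Yb : Matrix (Fin m) (Fin m) ℝ} (hY : Y.PosSemidef)
    (hYb : Yb.PosSemidef) (Θ Θb : Matrix (Fin m) (Fin n) ℝ) (x : Ω → Fin n → ℝ)
    (u : Ω → Fin m → ℝ) : 0 ≤ penalty μ Y Yb Θ Θb x u :=
  add_nonneg (integral_nonneg fun _ => (posSemidef_iff_forall.1 hY).2 _)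
    ((posSemidef_iff_forall.1 hYb).2 _)

theorem integral_centered_sum (A : Matrix (Fin n) (Fin n) ℝ) (B : Matrix (Fin n) (Fin m) ℝ)
    (C : Matrix (Fin m) (Fin m) ℝ) {x : Ω → Fin n → ℝ} {u : Ω → Fin m → ℝ}
    (hx : MemLp x 2 μ) (hu : MemLp u 2 μ) :
    ∫ z, (x z ⬝ᵥ A *ᵥ x z + 2 * (x z ⬝ᵥ B *ᵥ u z) + u z ⬝ᵥ C *ᵥ u z) ∂μ
      = ∫ z, x z ⬝ᵥ A *ᵥ x z ∂μ + 2 * ∫ z, x z ⬝ᵥ B *ᵥ u z ∂μ + ∫ z, u z ⬝ᵥ C *ᵥ u z ∂μ := by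
  have h1 := hx.integrable_dotProduct_mulVec hx A
  have h2 := (hx.integrable_dotProduct_mulVec hu B).const_mul 2
  have h3 := hu.integrable_dotProduct_mulVec hu C
  have h12 : Integrable (fun z => x z ⬝ᵥ A *ᵥ x z + 2 * (x z ⬝ᵥ B *ᵥ u z)) μ := h1.add h2
  rw [integral_add h12 h3, integral_add h1 h2, integral_const_mul]

variable [IsProbabilityMeasure μ]

/-- Fluctuations and means decouple because all mixed terms integrate to zero. The weights `P1`,
`Pi1` are arbitrary symmetric matrices; no Riccati equation enters yet. -/
theorem valueAt_step_add_stageCost (p : MFLQ n m) {w : ℕ → Ω → ℝ}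
    {k : ℕ} (h : IsWhiteNoise 𝓕 μ (w k)) {P1 Pi1 : Matrix (Fin n) (Fin n) ℝ} (hP : P1ᵀ = P1)
    (hPi : Pi1ᵀ = Pi1) {x : Ω → Fin n → ℝ} {u : Ω → Fin m → ℝ} (hxm : Measurable[𝓕] x)
    (hx : MemLp x 2 μ) (hum : Measurable[𝓕] u) (hu : MemLp u 2 μ) :
    valueAt μ P1 Pi1 (p.step μ w k x u) + p.stageCost μ k x u
      = ∫ z, ((x z - ∫ y, x y ∂μ) ⬝ᵥ p.lyap k P1 *ᵥ (x z - ∫ y, x y ∂μ)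
          + 2 * ((u z - ∫ y, u y ∂μ) ⬝ᵥ p.hh k P1 *ᵥ (x z - ∫ y, x y ∂μ))
          + (u z - ∫ y, u y ∂μ) ⬝ᵥ p.ups k P1 *ᵥ (u z - ∫ y, u y ∂μ)) ∂μ
        + ((∫ y, x y ∂μ) ⬝ᵥ p.lyapBar k P1 Pi1 *ᵥ (∫ y, x y ∂μ)
          + 2 * ((∫ y, u y ∂μ) ⬝ᵥ p.hhBar k P1 Pi1 *ᵥ (∫ y, x y ∂μ))
          + (∫ y, u y ∂μ) ⬝ᵥ p.upsBar k P1 Pi1 *ᵥ (∫ y, u y ∂μ)) := by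
  have hX := memLp_sub_mean hx
  have hU := memLp_sub_mean hu
  have hX0 := integral_sub_mean hx
  have hU0 := integral_sub_mean hu
  have hXm : Measurable[𝓕] fun z => x z - ∫ y, x y ∂μ :=
    (measurable_id.sub_const _).comp hxm
  have hUm : Measurable[𝓕] fun z => u z - ∫ y, u y ∂μ :=
    (measurable_id.sub_const _).comp hum
  -- Centring the running cost sends the mean parts of `Q`, `S`, `R` to the barred weights, which is
  -- why those appear as sums.
  have hst : p.stageCost μ k x u
      = ∫ z, ((x z - ∫ y, x y ∂μ) ⬝ᵥ p.Q k *ᵥ (x z - ∫ y, x y ∂μ)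
          + 2 * ((x z - ∫ y, x y ∂μ) ⬝ᵥ p.S k *ᵥ (u z - ∫ y, u y ∂μ))
          + (u z - ∫ y, u y ∂μ) ⬝ᵥ p.R k *ᵥ (u z - ∫ y, u y ∂μ)) ∂μ
        + ((∫ y, x y ∂μ) ⬝ᵥ (p.Q k + p.Qb k) *ᵥ (∫ y, x y ∂μ)
          + 2 * ((∫ y, x y ∂μ) ⬝ᵥ (p.S k + p.Sb k) *ᵥ (∫ y, u y ∂μ))
          + (∫ y, u y ∂μ) ⬝ᵥ (p.R k + p.Rb k) *ᵥ (∫ y, u y ∂μ)) := by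
    rw [stageCost, integral_centered_sum _ _ _ hx hu, integral_centered_sum _ _ _ hX hU,
      integral_centered hx hx, integral_centered hx hu, integral_centered hu hu]
    simp only [add_mulVec, dotProduct_add]
    ring
  rw [hst]
  generalize hxb : ∫ y, x y ∂μ = xb at *
  generalize hub : ∫ y, u y ∂μ = ub at *
  generalize hXe : (fun z => x z - xb) = X at *
  generalize hUe : (fun z => u z - ub) = U at *
  have eX : ∀ z, x z - xb = X z := fun z => congrFun hXe z
  have eU : ∀ z, u z - ub = U z := fun z => congrFun hUe z
  simp only [eX, eU]
  have lin : ∀ (A : Matrix (Fin n) (Fin n) ℝ) (B : Matrix (Fin n) (Fin m) ℝ),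
      Measurable[𝓕] (fun z => A *ᵥ X z + B *ᵥ U z) ∧ MemLp (fun z => A *ᵥ X z + B *ᵥ U z) 2 μ ∧
        ∫ z, (A *ᵥ X z + B *ᵥ U z) ∂μ = 0 := by
    intro A B
    refine ⟨?_, (hX.mulVec A).add (hU.mulVec B), ?_⟩
    · have : Continuous fun q : (Fin n → ℝ) × (Fin m → ℝ) => A *ᵥ q.1 + B *ᵥ q.2 :=
        (continuous_const.matrix_mulVec continuous_fst).add
          (continuous_const.matrix_mulVec continuous_snd)
      exact this.measurable.comp (hXm.prodMk hUm)
    · rw [integral_add ((hX.mulVec A).integrable (by norm_num))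
        ((hU.mulVec B).integrable (by norm_num)), integral_mulVec hX, integral_mulVec hU, hX0,
        hU0]
      simp
  obtain ⟨am, a2, a0⟩ := lin (p.A k) (p.B k)
  obtain ⟨cm, c2, c0⟩ := lin (p.C k) (p.D k)
  set ab := (p.A k + p.Ab k) *ᵥ xb + (p.B k + p.Bb k) *ᵥ ub with hab
  set cb := (p.C k + p.Cb k) *ᵥ xb + (p.D k + p.Db k) *ᵥ ub with hcb
  have cbm : Measurable[𝓕] fun z => p.C k *ᵥ X z + p.D k *ᵥ U z + cb :=
    (measurable_id.add_const _).comp cm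
  have cb2 : MemLp (fun z => p.C k *ᵥ X z + p.D k *ᵥ U z + cb) 2 μ := c2.add (memLp_const _)
  -- The next state is a centred part plus the deterministic vector `ab`; the vector `cb`, built
  -- from the means, stays inside the noise coefficient.
  have hstep : ∀ z, p.step μ w k x u z = (p.A k *ᵥ X z + p.B k *ᵥ U z)
      + w k z • (p.C k *ᵥ X z + p.D k *ᵥ U z + cb) + ab := by
    intro z
    simp only [step, hab, hcb, hxb, hub, ← eX, ← eU, mulVec_sub, add_mulVec]
    module
  have hw2 := h.memLp_smul cbm cb2
  have hmean : ∫ z, p.step μ w k x u z ∂μ = ab := by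
    simp_rw [hstep]
    have i1 := a2.integrable (q := 2) (by norm_num)
    have i2 := hw2.integrable (q := 2) (by norm_num)
    have i12 : Integrable (fun z => (p.A k *ᵥ X z + p.B k *ᵥ U z)
      + w k z • (p.C k *ᵥ X z + p.D k *ᵥ U z + cb)) μ := i1.add i2
    rw [integral_add i12 (integrable_const _), integral_add i1 i2, a0,
      h.integral_smul_eq_zero cbm cb2]
    simp
  rw [valueAt, hmean]
  simp only [hstep, add_sub_cancel_right]
  -- The term `cb' P1 cb` split off here is a function of the means alone weighted by `P1`: this is
  -- how `P`, not only `Π`, gets into the barred matrices.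
  rw [h.integral_quadratic am a2 cbm cb2, integral_add_const_quadratic c2 c2 c0 c0]
  have key : ∀ z, X z ⬝ᵥ p.lyap k P1 *ᵥ X z + 2 * (U z ⬝ᵥ p.hh k P1 *ᵥ X z)
      + U z ⬝ᵥ p.ups k P1 *ᵥ U z = _ := fun z => (quadratic_step hP hP (X z) (U z)).symm
  have keyb := (quadratic_step (A := p.A k + p.Ab k) (C := p.C k + p.Cb k) (Q := p.Q k + p.Qb k)
    (B := p.B k + p.Bb k) (D := p.D k + p.Db k) (S := p.S k + p.Sb k) (R := p.R k + p.Rb k)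
    hP hPi xb ub).symm
  rw [transpose_add (p.S k), ← add_assoc _ (p.S k)ᵀ] at keyb
  simp_rw [key]
  rw [lyapBar, hhBar, upsBar, keyb]
  have j1 := a2.integrable_dotProduct_mulVec a2 P1
  have j2 := c2.integrable_dotProduct_mulVec c2 P1
  have j12 : Integrable (fun z => (p.A k *ᵥ X z + p.B k *ᵥ U z) ⬝ᵥ P1 *ᵥ
      (p.A k *ᵥ X z + p.B k *ᵥ U z) + (p.C k *ᵥ X z + p.D k *ᵥ U z) ⬝ᵥ P1 *ᵥ
      (p.C k *ᵥ X z + p.D k *ᵥ U z)) μ := j1.add j2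
  have j3 : Integrable (fun z => X z ⬝ᵥ p.Q k *ᵥ X z + 2 * (X z ⬝ᵥ p.S k *ᵥ U z)
      + U z ⬝ᵥ p.R k *ᵥ U z) μ :=
    ((hX.integrable_dotProduct_mulVec hX _).add
      ((hX.integrable_dotProduct_mulVec hU _).const_mul 2)).add
      (hU.integrable_dotProduct_mulVec hU _)
  rw [integral_add j12 j3, integral_add j1 j2]
  ring

theorem IsGainForm.valueAt_step {p : MFLQ n m} {P Pi : ℕ → Matrix (Fin n) (Fin n) ℝ}
    {Θ Θb : ℕ → Matrix (Fin m) (Fin n) ℝ} {k : ℕ} (hg : p.IsGainForm P Pi Θ Θb k)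
    {w : ℕ → Ω → ℝ} (h : IsWhiteNoise 𝓕 μ (w k))
    {x : Ω → Fin n → ℝ} {u : Ω → Fin m → ℝ} (hxm : Measurable[𝓕] x)
    (hx : MemLp x 2 μ) (hum : Measurable[𝓕] u) (hu : MemLp u 2 μ) :
    valueAt μ (P (k + 1)) (Pi (k + 1)) (p.step μ w k x u) + p.stageCost μ k x u
      = valueAt μ (P k) (Pi k) x + penalty μ (p.ups k (P (k + 1)))
        (p.upsBar k (P (k + 1)) (Pi (k + 1))) (Θ k) (Θb k) x u := by
  rw [valueAt_step_add_stageCost p h hg.symm hg.symmBar hxm hx hum hu]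
  simp_rw [complete_square (p.ups_transpose k hg.symm) hg.gain]
  rw [complete_square (p.upsBar_transpose k hg.symm hg.symmBar) hg.gainBar, ← hg.eq, ← hg.eqBar]
  have hX := memLp_sub_mean hx
  have hV : MemLp (fun z => (u z - ∫ y, u y ∂μ) - Θ k *ᵥ (x z - ∫ y, x y ∂μ)) 2 μ :=
    (memLp_sub_mean hu).sub (hX.mulVec (Θ k))
  rw [integral_add (hX.integrable_dotProduct_mulVec hX _) (hV.integrable_dotProduct_mulVec hV _),
    valueAt, penalty]
  ring

/-- `x` solves the state equation on `{l, …, N}` under the control `u`. -/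
def IsTrajectory (p : MFLQ n m) (μ : Measure Ω) (w : ℕ → Ω → ℝ) (l : ℕ)
    (x : ℕ → Ω → Fin n → ℝ) (u : ℕ → Ω → Fin m → ℝ) : Prop :=
  ∀ k, l ≤ k → k < p.N → x (k + 1) = p.step μ w k (x k) (u k)

end Trajectory

/-! ### Adapted trajectories and the telescoped cost -/

section Noise

variable {n m : ℕ} {Ω : Type*} {𝓖 : MeasurableSpace Ω} {mΩ : MeasurableSpace Ω} {μ : Measure Ω}
  {w : ℕ → Ω → ℝ} {N : ℕ}

theorem info_le (hw : IsNoise 𝓖 μ w N) (k : ℕ) : info 𝓖 w k ≤ mΩ :=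
  sup_le hw.le (iSup₂_le fun j _ => (hw.meas j).comap_le)

theorem info_mono {j k : ℕ} (h : j ≤ k) : info 𝓖 w j ≤ info 𝓖 w k :=
  sup_le_sup_left (biSup_mono fun i hi => by simp at hi ⊢; omega) _

theorem measurable_noise_info (k : ℕ) : Measurable[info 𝓖 w (k + 1)] (w k) := by
  refine Measurable.mono (comap_measurable (w k)) ?_ le_rfl
  exact le_sup_of_le_right
    (le_iSup₂ (f := fun j (_ : j ∈ Finset.range (k + 1)) => MeasurableSpace.comap (w j) inferInstance)
      k (by simp))

theorem isWhiteNoise (hw : IsNoise 𝓖 μ w N) {k : ℕ} (hk : k < N) :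
    IsWhiteNoise (info 𝓖 w k) μ (w k) :=
  ⟨info_le hw k, hw.meas k, hw.memLp k hk, hw.condExp_zero k hk, hw.condExp_sq k hk⟩

theorem measurable_affine {𝓕 : MeasurableSpace Ω} {i : ℕ} {x : Ω → Fin n → ℝ}
    {u : Ω → Fin m → ℝ} (hxm : Measurable[𝓕] x) (hum : Measurable[𝓕] u)
    (A : Matrix (Fin i) (Fin n) ℝ) (B : Matrix (Fin i) (Fin m) ℝ) (c : Fin i → ℝ) :
    Measurable[𝓕] fun z => A *ᵥ x z + B *ᵥ u z + c := by
  have : Continuous fun q : (Fin n → ℝ) × (Fin m → ℝ) => A *ᵥ q.1 + B *ᵥ q.2 + c :=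
    ((continuous_const.matrix_mulVec continuous_fst).add
      (continuous_const.matrix_mulVec continuous_snd)).add continuous_const
  exact this.measurable.comp (hxm.prodMk hum)

theorem isTrajectory_state (p : MFLQ n m) (l : ℕ) (ξ : Ω → Fin n → ℝ)
    (u : ℕ → Ω → Fin m → ℝ) : p.IsTrajectory μ w l (p.state μ w l ξ u) u := by
  intro k hlk _
  rw [state, if_neg (by omega)]

theorem state_self (p : MFLQ n m) (l : ℕ) (ξ : Ω → Fin n → ℝ)
    (u : ℕ → Ω → Fin m → ℝ) : p.state μ w l ξ u l = ξ := by
  cases l with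
  | zero => rfl
  | succ l => rw [state, if_pos (by omega)]

theorem isTrajectory_closedLoopState (p : MFLQ n m) (l : ℕ) (ξ : Ω → Fin n → ℝ)
    (Θ Θb : ℕ → Matrix (Fin m) (Fin n) ℝ) (v : ℕ → Fin m → ℝ) :
    p.IsTrajectory μ w l (p.closedLoopState μ w l ξ Θ Θb v)
      fun k => feedback μ Θ Θb v k (p.closedLoopState μ w l ξ Θ Θb v k) := by
  intro k hlk _
  rw [closedLoopState, if_neg (by omega)]

theorem closedLoopState_self (p : MFLQ n m) (l : ℕ) (ξ : Ω → Fin n → ℝ)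
    (Θ Θb : ℕ → Matrix (Fin m) (Fin n) ℝ) (v : ℕ → Fin m → ℝ) :
    p.closedLoopState μ w l ξ Θ Θb v l = ξ := by
  cases l with
  | zero => rfl
  | succ l => rw [closedLoopState, if_pos (by omega)]

/-- Uniqueness for the state equation: it identifies the closed-loop state with the `state` in
`cost` driven by the feedback's outcome. -/
theorem IsTrajectory.eq_state {p : MFLQ n m} {l : ℕ}
    {x : ℕ → Ω → Fin n → ℝ} {u : ℕ → Ω → Fin m → ℝ} (ht : p.IsTrajectory μ w l x u) {k : ℕ}
    (hlk : l ≤ k) (hk : k ≤ p.N) : p.state μ w l (x l) u k = x k := by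
  induction k, hlk using Nat.le_induction with
  | base => exact state_self _ _ _ _
  | succ k hlk ih =>
    rw [ht k hlk (by omega), isTrajectory_state p l (x l) u k hlk (by omega), ih (by omega)]

variable [IsProbabilityMeasure μ]

theorem memLp_affine {i : ℕ} {x : Ω → Fin n → ℝ}
    {u : Ω → Fin m → ℝ} (hx : MemLp x 2 μ) (hu : MemLp u 2 μ)
    (A : Matrix (Fin i) (Fin n) ℝ) (B : Matrix (Fin i) (Fin m) ℝ) (c : Fin i → ℝ) :
    MemLp (fun z => A *ᵥ x z + B *ᵥ u z + c) 2 μ :=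
  ((hx.mulVec A).add (hu.mulVec B)).add (memLp_const c)

theorem step_adapted (p : MFLQ n m) (hw : IsNoise 𝓖 μ w p.N) {k : ℕ} (hk : k < p.N)
    {x : Ω → Fin n → ℝ} {u : Ω → Fin m → ℝ} (hx : Measurable[info 𝓖 w k] x ∧ MemLp x 2 μ)
    (hu : Measurable[info 𝓖 w k] u ∧ MemLp u 2 μ) :
    Measurable[info 𝓖 w (k + 1)] (p.step μ w k x u) ∧ MemLp (p.step μ w k x u) 2 μ := by
  set a := p.Ab k *ᵥ (∫ y, x y ∂μ) + p.Bb k *ᵥ (∫ y, u y ∂μ) with ha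
  set c := p.Cb k *ᵥ (∫ y, x y ∂μ) + p.Db k *ᵥ (∫ y, u y ∂μ) with hc
  have e : p.step μ w k x u = fun z => (p.A k *ᵥ x z + p.B k *ᵥ u z + a)
      + w k z • (p.C k *ᵥ x z + p.D k *ᵥ u z + c) := by
    ext1 z
    simp only [step, ha, hc]
    module
  rw [e]
  have h1 := measurable_affine hx.1 hu.1 (p.A k) (p.B k) a
  have h2 := measurable_affine hx.1 hu.1 (p.C k) (p.D k) c
  have hle : info 𝓖 w k ≤ info 𝓖 w (k + 1) := info_mono k.le_succ
  constructor
  · have : Continuous fun q : (Fin n → ℝ) × ℝ × (Fin n → ℝ) => q.1 + q.2.1 • q.2.2 := by fun_prop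
    exact this.measurable.comp ((h1.mono hle le_rfl).prodMk
      ((measurable_noise_info k).prodMk (h2.mono hle le_rfl)))
  · exact (memLp_affine hx.2 hu.2 _ _ _).add
      ((isWhiteNoise hw hk).memLp_smul h2 (memLp_affine hx.2 hu.2 _ _ _))

theorem IsTrajectory.adapted {p : MFLQ n m} (hw : IsNoise 𝓖 μ w p.N) {l : ℕ}
    {x : ℕ → Ω → Fin n → ℝ} {u : ℕ → Ω → Fin m → ℝ} (ht : p.IsTrajectory μ w l x u)
    (hl : Measurable[info 𝓖 w l] (x l) ∧ MemLp (x l) 2 μ)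
    (hu : u ∈ admissible m 𝓖 μ w l p.N) {k : ℕ} (hlk : l ≤ k) (hk : k ≤ p.N) :
    Measurable[info 𝓖 w k] (x k) ∧ MemLp (x k) 2 μ := by
  induction k, hlk using Nat.le_induction with
  | base => exact hl
  | succ k hlk ih =>
    rw [ht k hlk (by omega)]
    exact step_adapted p hw (by omega) (ih (by omega)) (hu k hlk (by omega))

/-- Telescoping of the one-step identity `IsGainForm.valueAt_step`, by induction on the right
endpoint. -/
theorem IsTrajectory.valueAt_add_sum {p : MFLQ n m} (hw : IsNoise 𝓖 μ w p.N) {l : ℕ}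
    (hlN : l ≤ p.N) {x : ℕ → Ω → Fin n → ℝ} {u : ℕ → Ω → Fin m → ℝ}
    (ht : p.IsTrajectory μ w l x u) (hl : Measurable[info 𝓖 w l] (x l) ∧ MemLp (x l) 2 μ)
    (hu : u ∈ admissible m 𝓖 μ w l p.N) {P Pi : ℕ → Matrix (Fin n) (Fin n) ℝ}
    {Θ Θb : ℕ → Matrix (Fin m) (Fin n) ℝ}
    (hg : ∀ k, l ≤ k → k < p.N → p.IsGainForm P Pi Θ Θb k) :
    valueAt μ (P p.N) (Pi p.N) (x p.N) + ∑ k ∈ Finset.Ico l p.N, p.stageCost μ k (x k) (u k)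
      = valueAt μ (P l) (Pi l) (x l) + ∑ k ∈ Finset.Ico l p.N,
        penalty μ (p.ups k (P (k + 1))) (p.upsBar k (P (k + 1)) (Pi (k + 1))) (Θ k) (Θb k)
          (x k) (u k) := by
  suffices ∀ K, l ≤ K → K ≤ p.N → valueAt μ (P K) (Pi K) (x K)
      + ∑ k ∈ Finset.Ico l K, p.stageCost μ k (x k) (u k)
      = valueAt μ (P l) (Pi l) (x l) + ∑ k ∈ Finset.Ico l K,
        penalty μ (p.ups k (P (k + 1))) (p.upsBar k (P (k + 1)) (Pi (k + 1))) (Θ k) (Θb k)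
          (x k) (u k) from this p.N hlN le_rfl
  intro K hK
  induction K, hK using Nat.le_induction with
  | base => simp
  | succ k hlk ih =>
    intro hk
    have hx := ht.adapted hw hl hu hlk (by omega)
    have huk := hu k hlk (by omega)
    have := (hg k hlk (by omega)).valueAt_step (isWhiteNoise hw (by omega : k < p.N)) hx.1 hx.2
      huk.1 huk.2
    rw [Finset.sum_Ico_succ_top hlk, Finset.sum_Ico_succ_top hlk, ht k hlk (by omega)]
    linarith [ih (by omega)]

theorem feedback_adapted {k : ℕ} {x : Ω → Fin n → ℝ}
    (hx : Measurable[info 𝓖 w k] x ∧ MemLp x 2 μ) (Θ Θb : ℕ → Matrix (Fin m) (Fin n) ℝ)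
    (v : ℕ → Fin m → ℝ) :
    Measurable[info 𝓖 w k] (feedback μ Θ Θb v k x) ∧ MemLp (feedback μ Θ Θb v k x) 2 μ := by
  -- The zero matrix casts the feedback in the shape of the two-variable affine lemmas, with `x` in
  -- both slots.
  have e : feedback μ Θ Θb v k x = fun z => Θ k *ᵥ x z + (0 : Matrix (Fin m) (Fin n) ℝ) *ᵥ x z
      + (Θb k *ᵥ (∫ y, x y ∂μ) + v k) := by
    ext1 z
    simp [feedback, add_assoc]
  rw [e]
  exact ⟨measurable_affine hx.1 hx.1 _ _ _, memLp_affine hx.2 hx.2 _ _ _⟩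

theorem closedLoopState_adapted (p : MFLQ n m) (hw : IsNoise 𝓖 μ w p.N) {l : ℕ}
    {ξ : Ω → Fin n → ℝ} (hξ : Measurable[info 𝓖 w l] ξ ∧ MemLp ξ 2 μ)
    (Θ Θb : ℕ → Matrix (Fin m) (Fin n) ℝ) (v : ℕ → Fin m → ℝ) {k : ℕ} (hlk : l ≤ k)
    (hk : k ≤ p.N) :
    Measurable[info 𝓖 w k] (p.closedLoopState μ w l ξ Θ Θb v k)
      ∧ MemLp (p.closedLoopState μ w l ξ Θ Θb v k) 2 μ := by
  induction k, hlk using Nat.le_induction with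
  | base => rwa [closedLoopState_self]
  | succ k hlk ih =>
    rw [isTrajectory_closedLoopState p l ξ Θ Θb v k hlk (by omega)]
    exact step_adapted p hw (by omega) (ih (by omega)) (feedback_adapted (ih (by omega)) _ _ _)

/-- The cost as a sum of expectations along a trajectory. -/
theorem IsTrajectory.cost_eq {p : MFLQ n m} (hw : IsNoise 𝓖 μ w p.N) {l : ℕ} (hlN : l ≤ p.N)
    {x : ℕ → Ω → Fin n → ℝ} {u : ℕ → Ω → Fin m → ℝ} (ht : p.IsTrajectory μ w l x u)
    (hl : Measurable[info 𝓖 w l] (x l) ∧ MemLp (x l) 2 μ)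
    (hu : u ∈ admissible m 𝓖 μ w l p.N) :
    p.cost μ w l (x l) u = valueAt μ p.G (p.G + p.Gb) (x p.N)
      + ∑ k ∈ Finset.Ico l p.N, p.stageCost μ k (x k) (u k) := by
  have hx : ∀ k, l ≤ k → k ≤ p.N → MemLp (x k) 2 μ := fun k h1 h2 => (ht.adapted hw hl hu h1 h2).2
  have hs : ∀ k ∈ Finset.Ico l p.N, p.state μ w l (x l) u k = x k := fun k hk =>
    ht.eq_state (Finset.mem_Ico.1 hk).1 (Finset.mem_Ico.1 hk).2.le
  have hN := hx p.N hlN le_rfl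
  have hi : ∀ k ∈ Finset.Ico l p.N, Integrable (fun z => x k z ⬝ᵥ p.Q k *ᵥ x k z
      + 2 * (x k z ⬝ᵥ p.S k *ᵥ u k z) + u k z ⬝ᵥ p.R k *ᵥ u k z) μ := by
    intro k hk
    rw [Finset.mem_Ico] at hk
    have h1 := hx k hk.1 hk.2.le
    have h2 := (hu k hk.1 hk.2).2
    exact ((h1.integrable_dotProduct_mulVec h1 _).add
      ((h1.integrable_dotProduct_mulVec h2 _).const_mul 2)).add
      (h2.integrable_dotProduct_mulVec h2 _)
  rw [cost]
  simp only [ht.eq_state hlN le_rfl]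
  rw [Finset.sum_congr rfl fun k hk => by rw [hs k hk]]
  have e : ∀ z, ∑ k ∈ Finset.Ico l p.N, (p.state μ w l (x l) u k z ⬝ᵥ
        p.Q k *ᵥ p.state μ w l (x l) u k z + 2 * (p.state μ w l (x l) u k z ⬝ᵥ p.S k *ᵥ u k z)
        + u k z ⬝ᵥ p.R k *ᵥ u k z)
      = ∑ k ∈ Finset.Ico l p.N, (x k z ⬝ᵥ p.Q k *ᵥ x k z
      + 2 * (x k z ⬝ᵥ p.S k *ᵥ u k z) + u k z ⬝ᵥ p.R k *ᵥ u k z) := fun z =>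
    Finset.sum_congr rfl fun k hk => by rw [hs k hk]
  simp_rw [e]
  -- Centring the terminal state moves `(𝔼x)'G 𝔼x` to the mean part, hence the weight `G + Gb`.
  rw [integral_add_add_add (hN.integrable_dotProduct_mulVec hN _) (integrable_const _)
    (integrable_finsetSum _ hi) (integrable_const _), integral_finsetSum _ hi,
    integral_centered hN hN, valueAt]
  simp only [stageCost, Finset.sum_add_distrib, integral_const, probReal_univ, one_smul,
    add_mulVec, dotProduct_add]
  ring

end Noise

end MFLQ

namespace MFLQ

/-! ### Solutions of the Riccati equation -/

section Riccati

variable {n m : ℕ} (p : MFLQ n m)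

/-- The backward Riccati recursion, in terms of the time to go. -/
noncomputable def riccati : ℕ → Matrix (Fin n) (Fin n) ℝ × Matrix (Fin n) (Fin n) ℝ
  | 0 => (p.G, p.G + p.Gb)
  | i + 1 =>
    let q := riccati i
    let k := p.N - (i + 1)
    (p.lyap k q.1 - (p.hh k q.1)ᵀ * pinv (p.ups k q.1) * p.hh k q.1,
      p.lyapBar k q.1 q.2
        - (p.hhBar k q.1 q.2)ᵀ * pinv (p.upsBar k q.1 q.2) * p.hhBar k q.1 q.2)

/-- The recursion never breaks down, since `pinv` is defined for every matrix; regularity is a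
separate matter. -/
theorem exists_isGRESolution : ∃ P Pi, p.IsGRESolution P Pi := by
  refine ⟨fun k => (p.riccati (p.N - k)).1, fun k => (p.riccati (p.N - k)).2, by simp [riccati],
    by simp [riccati], fun k hk => ?_⟩
  obtain ⟨i, hi⟩ : ∃ i, p.N = k + (i + 1) := ⟨p.N - k - 1, by omega⟩
  have e1 : p.N - k = i + 1 := by omega
  have e2 : p.N - (k + 1) = i := by omega
  have e3 : p.N - (i + 1) = k := by omega
  simp only [e1, e2, riccati, e3]
  exact ⟨rfl, rfl⟩

variable {p} {P Pi : ℕ → Matrix (Fin n) (Fin n) ℝ}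

/-- Backward induction on `{0, …, N}`. -/
theorem backward_induction {N : ℕ} {motive : ℕ → Prop} (last : motive N)
    (step : ∀ k < N, motive (k + 1) → motive k) {k : ℕ} (hk : k ≤ N) : motive k :=
  Nat.decreasingInduction (motive := fun k _ => motive k) (fun k hk => step k hk) last hk

theorem IsGRESolution.transpose (h : p.IsGRESolution P Pi) {k : ℕ} (hk : k ≤ p.N) :
    (P k)ᵀ = P k ∧ (Pi k)ᵀ = Pi k := by
  refine backward_induction (motive := fun k => (P k)ᵀ = P k ∧ (Pi k)ᵀ = Pi k) ?_ ?_ hk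
  · simp [h.1, h.2.1, p.G_symm, p.Gb_symm]
  · rintro k hk ⟨h1, h2⟩
    have e : P k = p.lyap k (P (k + 1)) - _ := (h.2.2 k hk).1
    have eb : Pi k = p.lyapBar k (P (k + 1)) (Pi (k + 1)) - _ := (h.2.2 k hk).2
    rw [e, eb]
    simp only [transpose_sub, transpose_mul, transpose_transpose, p.lyap_transpose k h1,
      p.lyapBar_transpose k h1 h2, pinv_transpose (p.ups_transpose k h1),
      pinv_transpose (p.upsBar_transpose k h1 h2), Matrix.mul_assoc, and_self]

theorem IsGRESolution.isGainForm (h : p.IsGRESolution P Pi) {k : ℕ} (hk : k < p.N)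
    {Θ Θb : ℕ → Matrix (Fin m) (Fin n) ℝ}
    (hΘ : p.ups k (P (k + 1)) * Θ k = -p.hh k (P (k + 1)))
    (hΘb : p.upsBar k (P (k + 1)) (Pi (k + 1)) * Θb k = -p.hhBar k (P (k + 1)) (Pi (k + 1))) :
    p.IsGainForm P Pi Θ Θb k := by
  obtain ⟨h1, h2⟩ := h.transpose (k := k + 1) hk
  refine ⟨h1, h2, hΘ, hΘb, (h.2.2 k hk).1.trans ?_, (h.2.2 k hk).2.trans ?_⟩
  · rw [transpose_mul_pinv_mul_of_mul_eq_neg (p.ups_transpose k h1) hΘ, sub_neg_eq_add, lyap]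
  · rw [transpose_mul_pinv_mul_of_mul_eq_neg (p.upsBar_transpose k h1 h2) hΘb, sub_neg_eq_add,
      lyapBar]

theorem isGRESolution_of_isGainForm {Θ Θb : ℕ → Matrix (Fin m) (Fin n) ℝ} (hN : P p.N = p.G)
    (hNb : Pi p.N = p.G + p.Gb) (h : ∀ k < p.N, p.IsGainForm P Pi Θ Θb k) :
    p.IsGRESolution P Pi := by
  refine ⟨hN, hNb, fun k hk => ?_⟩
  have g := h k hk
  refine ⟨g.eq.trans ?_, g.eqBar.trans ?_⟩
  · rw [transpose_mul_pinv_mul_of_mul_eq_neg (p.ups_transpose k g.symm) g.gain, sub_neg_eq_add,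
      lyap]
  · rw [transpose_mul_pinv_mul_of_mul_eq_neg (p.upsBar_transpose k g.symm g.symmBar) g.gainBar,
      sub_neg_eq_add, lyapBar]

theorem IsGRESolution.isGainForm_gain (h : p.IsGRESolution P Pi) {k : ℕ} (hk : k < p.N)
    (hu : IsUnit (p.ups k (P (k + 1)))) (hub : IsUnit (p.upsBar k (P (k + 1)) (Pi (k + 1)))) :
    p.IsGainForm P Pi (p.gain P) (p.gainBar P Pi) k := by
  refine h.isGainForm hk ?_ ?_
  · rw [MFLQ.gain, Matrix.mul_neg, mul_nonsing_inv_cancel_left _ _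
      ((isUnit_iff_isUnit_det _).1 hu)]
  · rw [MFLQ.gainBar, Matrix.mul_neg, mul_nonsing_inv_cancel_left _ _
      ((isUnit_iff_isUnit_det _).1 hub)]

end Riccati

/-! ### Coercive costs have strongly regular Riccati solutions -/

section Coercive

variable {n m : ℕ} {Ω : Type*} {𝓖 : MeasurableSpace Ω} {mΩ : MeasurableSpace Ω} {μ : Measure Ω}
  {w : ℕ → Ω → ℝ}

theorem step_zero (p : MFLQ n m) (k : ℕ) :
    p.step μ w k (fun _ => (0 : Fin n → ℝ)) (fun _ => 0) = fun _ => 0 := by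
  ext1 z
  simp [step]

theorem stageCost_zero (p : MFLQ n m) (k : ℕ) :
    p.stageCost μ k (fun _ => 0) (fun _ => 0) = 0 := by
  simp [stageCost]

variable [IsProbabilityMeasure μ]

/-- The gain `Θb - Θ` on the mean makes the control equal to `Θ (x - 𝔼x) + Θb 𝔼x`, so `Θ` acts on
fluctuations and `Θb` on means. -/
theorem integral_feedback {Θ Θb : ℕ → Matrix (Fin m) (Fin n) ℝ} {k : ℕ} {x : Ω → Fin n → ℝ}
    (hx : MemLp x 2 μ) :
    ∫ z, feedback μ Θ (fun k => Θb k - Θ k) (fun _ => 0) k x z ∂μ = Θb k *ᵥ ∫ z, x z ∂μ := by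
  simp only [feedback, add_zero]
  rw [integral_add ((hx.mulVec _).integrable (by norm_num)) (integrable_const _),
    integral_mulVec hx]
  simp [sub_mulVec]

theorem penalty_feedback {Y Yb : Matrix (Fin m) (Fin m) ℝ} {Θ Θb : ℕ → Matrix (Fin m) (Fin n) ℝ}
    {k : ℕ} {x : Ω → Fin n → ℝ} (hx : MemLp x 2 μ) :
    penalty μ Y Yb (Θ k) (Θb k) x
      (feedback μ Θ (fun k => Θb k - Θ k) (fun _ => 0) k x) = 0 := by
  have e : ∀ z, feedback μ Θ (fun k => Θb k - Θ k) (fun _ => 0) k x z - Θb k *ᵥ (∫ z, x z ∂μ)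
      - Θ k *ᵥ (x z - ∫ z, x z ∂μ) = 0 := fun z => by
    simp only [feedback, sub_mulVec, mulVec_sub]
    module
  rw [penalty, integral_feedback hx]
  simp [e]

/-- Applying `u` at time `k` from the zero state and the feedback with the gains afterwards. -/
theorem coercive_step (p : MFLQ n m) (hw : IsNoise 𝓖 μ w p.N) {δ : ℝ} (hδ : 0 ≤ δ)
    (hc : ∀ u ∈ admissible m 𝓖 μ w 0 p.N,
      δ * ∑ k ∈ Finset.Ico 0 p.N, ∫ z, u k z ⬝ᵥ u k z ∂μ ≤ p.cost μ w 0 (fun _ => 0) u)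
    {P Pi : ℕ → Matrix (Fin n) (Fin n) ℝ} (hs : p.IsGRESolution P Pi)
    {Θ Θb : ℕ → Matrix (Fin m) (Fin n) ℝ} {k : ℕ} (hk : k < p.N)
    (hg : ∀ j, k < j → j < p.N → p.IsGainForm P Pi Θ Θb j) {u : Ω → Fin m → ℝ}
    (hu : Measurable[info 𝓖 w k] u ∧ MemLp u 2 μ) :
    δ * ∫ z, u z ⬝ᵥ u z ∂μ
      ≤ ∫ z, (u z - ∫ y, u y ∂μ) ⬝ᵥ p.ups k (P (k + 1)) *ᵥ (u z - ∫ y, u y ∂μ) ∂μ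
        + (∫ y, u y ∂μ) ⬝ᵥ p.upsBar k (P (k + 1)) (Pi (k + 1)) *ᵥ (∫ y, u y ∂μ) := by
  have h0 : Measurable[info 𝓖 w k] (fun _ : Ω => (0 : Fin n → ℝ)) ∧
      MemLp (fun _ : Ω => (0 : Fin n → ℝ)) 2 μ := ⟨measurable_const, memLp_const _⟩
  set ξ := p.step μ w k (fun _ => 0) u with hξ
  have hξa := step_adapted p hw hk h0 hu
  rw [← hξ] at hξa
  set y := p.closedLoopState μ w (k + 1) ξ Θ (fun k => Θb k - Θ k) (fun _ => 0) with hy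
  have hya : ∀ j, k + 1 ≤ j → j ≤ p.N → Measurable[info 𝓖 w j] (y j) ∧ MemLp (y j) 2 μ :=
    fun j h1 h2 => closedLoopState_adapted p hw hξa _ _ _ h1 h2
  set F : ℕ → Ω → Fin m → ℝ :=
    fun j => feedback μ Θ (fun k => Θb k - Θ k) (fun _ => 0) j (y j) with hF
  -- The test control: zero before `k`, `u` at `k`, feedback afterwards; its state `X` stays at zero
  -- up to and including time `k`.
  set U : ℕ → Ω → Fin m → ℝ := fun j => if j < k then fun _ => 0 else if j = k then u else F j
    with hU
  set X : ℕ → Ω → Fin n → ℝ := fun j => if j ≤ k then fun _ => 0 else y j with hX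
  have hUa : U ∈ admissible m 𝓖 μ w 0 p.N := by
    intro j _ hj
    simp only [hU]
    split_ifs with h1 h2
    · exact ⟨measurable_const, memLp_const _⟩
    · subst h2; exact hu
    · exact feedback_adapted (hya j (by omega) hj.le) _ _ _
  have hXlt : ∀ j ≤ k, X j = fun _ => 0 := fun j hj => if_pos hj
  have hXgt : ∀ j, k < j → X j = y j := fun j hj => if_neg (by omega)
  have hUlt : ∀ j < k, U j = fun _ => 0 := fun j hj => if_pos hj
  have hUeq : U k = u := by simp [hU]
  have hUgt : ∀ j, k < j → U j = F j := fun j hj => by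
    simp only [hU]; rw [if_neg (by omega), if_neg (by omega)]
  have hyk : y (k + 1) = ξ := closedLoopState_self _ _ _ _ _ _
  have htraj : p.IsTrajectory μ w 0 X U := by
    intro j _ hj
    rcases lt_trichotomy j k with h | h | h
    · rw [hXlt (j + 1) h, hXlt j h.le, hUlt j h, step_zero]
    · subst h
      rw [hXgt (j + 1) (by omega), hXlt j le_rfl, hUeq, hyk]
    · rw [hXgt (j + 1) (by omega), hXgt j h, hUgt j h]
      exact isTrajectory_closedLoopState p (k + 1) ξ _ _ _ j h hj
  have htraj' : p.IsTrajectory μ w (k + 1) X U := fun j _ hj => htraj j (Nat.zero_le j) hj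
  have hcost := htraj.cost_eq hw (Nat.zero_le _)
    (by rw [hXlt 0 (Nat.zero_le k)]; exact ⟨measurable_const, memLp_const _⟩) hUa
  rw [hXlt 0 (Nat.zero_le k)] at hcost
  have htel := htraj'.valueAt_add_sum hw hk
    (by rw [hXgt _ (by omega), hyk]; exact hξa)
    (fun j _ hj => hUa j (Nat.zero_le j) hj) (fun j h1 h2 => hg j h1 h2)
  -- After time `k` the feedback makes every penalty vanish, so the remaining cost is the value of
  -- `ξ`.
  rw [Finset.sum_eq_zero (s := Finset.Ico (k + 1) p.N) (f := fun k => penalty _ _ _ _ _ _ _),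
    add_zero, hXgt (k + 1) (by omega), hyk, hs.1, hs.2.1] at htel
  swap
  · intro j hj
    rw [Finset.mem_Ico] at hj
    rw [hUgt j hj.1, hXgt j hj.1]
    exact penalty_feedback (hya j hj.1 hj.2.le).2
  have hsum : ∑ j ∈ Finset.Ico 0 p.N, p.stageCost μ j (X j) (U j)
      = p.stageCost μ k (fun _ => 0) u
        + ∑ j ∈ Finset.Ico (k + 1) p.N, p.stageCost μ j (X j) (U j) := by
    rw [← Finset.sum_Ico_consecutive _ (Nat.zero_le k) hk.le, Finset.sum_eq_zero,
      Finset.sum_eq_sum_Ico_succ_bot hk, hXlt k le_rfl, hUeq, zero_add]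
    intro j hj
    rw [Finset.mem_Ico] at hj
    rw [hXlt j hj.2.le, hUlt j hj.2, stageCost_zero]
  obtain ⟨hP, hPi⟩ := hs.transpose (k := k + 1) hk
  -- From the zero state only the terms quadratic in `u` remain.
  have hval := valueAt_step_add_stageCost p (isWhiteNoise hw hk) hP hPi h0.1 h0.2 hu.1 hu.2
  simp only [integral_zero, sub_zero, mulVec_zero, dotProduct_zero, mul_zero, zero_add, add_zero] at hval
  have hle : ∫ z, u z ⬝ᵥ u z ∂μ ≤ ∑ j ∈ Finset.Ico 0 p.N, ∫ z, U j z ⬝ᵥ U j z ∂μ := by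
    have := Finset.single_le_sum (s := Finset.Ico 0 p.N) (f := fun j => ∫ z, U j z ⬝ᵥ U j z ∂μ)
      (fun j _ => integral_nonneg fun z => by
        simpa using dotProduct_star_self_nonneg (U j z)) (a := k) (by simp [hk])
    simpa [hUeq] using this
  have := hc U hUa
  have := mul_le_mul_of_nonneg_left hle hδ
  linarith

/-- The indicator of a nontrivial event minus its probability `r`; the variance is `r (1 - r)`. -/
theorem exists_centered_scalar (h𝓖 : NondegenerateInitial 𝓖 μ) (hle : 𝓖 ≤ mΩ) :
    ∃ f : Ω → ℝ, Measurable[𝓖] f ∧ MemLp f 2 μ ∧ ∫ z, f z ∂μ = 0 ∧ 0 < ∫ z, f z ^ 2 ∂μ := by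
  obtain ⟨s, hs, h0, h1⟩ := h𝓖
  have hs' := hle s hs
  have hi : MemLp (s.indicator fun _ => (1 : ℝ)) 2 μ := (memLp_const 1).indicator hs'
  have hi1 : Integrable (s.indicator fun _ => (1 : ℝ)) μ := hi.integrable (by norm_num)
  have e1 : ∫ z, s.indicator (fun _ => (1 : ℝ)) z ∂μ = μ.real s := by
    simp [integral_indicator hs']
  have hr0 : 0 < μ.real s := ENNReal.toReal_pos h0.ne' (measure_ne_top μ s)
  have hr1 : μ.real s < 1 := by
    have := (ENNReal.toReal_lt_toReal (measure_ne_top μ s) ENNReal.one_ne_top).2 h1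
    simpa [Measure.real] using this
  refine ⟨fun z => s.indicator (fun _ => 1) z - μ.real s,
    (measurable_id.sub_const _).comp (measurable_const.indicator hs), hi.sub (memLp_const _), ?_, ?_⟩
  · rw [integral_sub hi1 (integrable_const _), e1]
    simp
  · have e : ∀ z, (s.indicator (fun _ => (1 : ℝ)) z - μ.real s) ^ 2
        = (1 - 2 * μ.real s) * s.indicator (fun _ => (1 : ℝ)) z + μ.real s ^ 2 := fun z => by
      by_cases hz : z ∈ s
      · simp only [Set.indicator_of_mem hz]; ring
      · simp only [Set.indicator_of_notMem hz]; ring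
    simp_rw [e]
    rw [integral_add (hi1.const_mul _) (integrable_const _), integral_const_mul, e1]
    simp only [integral_const, probReal_univ, one_smul]
    nlinarith

/-- Once the later `Υ` and `Ῡ` are bounded below they are invertible, so the later gains exist and
`coercive_step` applies at time `k`. The coercivity constant itself serves as `α`. -/
theorem IsGRESolution.isStronglyRegular_of_coercive {p : MFLQ n m} (hw : IsNoise 𝓖 μ w p.N)
    (h𝓖 : NondegenerateInitial 𝓖 μ) {δ : ℝ} (hδ : 0 < δ)
    (hc : ∀ u ∈ admissible m 𝓖 μ w 0 p.N,
      δ * ∑ k ∈ Finset.Ico 0 p.N, ∫ z, u k z ⬝ᵥ u k z ∂μ ≤ p.cost μ w 0 (fun _ => 0) u)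
    {P Pi : ℕ → Matrix (Fin n) (Fin n) ℝ} (hs : p.IsGRESolution P Pi) :
    p.IsStronglyRegular P Pi := by
  refine ⟨hs, δ, hδ, ?_⟩
  -- The induction must carry the bound at all later times, since the test control uses every later
  -- gain.
  suffices ∀ k ≤ p.N, ∀ j, k ≤ j → j < p.N →
      (p.ups j (P (j + 1)) - δ • (1 : Matrix (Fin m) (Fin m) ℝ)).PosSemidef ∧
      (p.upsBar j (P (j + 1)) (Pi (j + 1)) - δ • (1 : Matrix (Fin m) (Fin m) ℝ)).PosSemidef from
    fun k hk => this 0 (Nat.zero_le _) k (Nat.zero_le _) hk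
  intro k hk
  refine backward_induction (motive := fun k => ∀ j, k ≤ j → j < p.N →
      (p.ups j (P (j + 1)) - δ • (1 : Matrix (Fin m) (Fin m) ℝ)).PosSemidef ∧
      (p.upsBar j (P (j + 1)) (Pi (j + 1)) - δ • (1 : Matrix (Fin m) (Fin m) ℝ)).PosSemidef)
    (fun j h1 h2 => by omega) ?_ hk
  intro k hk ih j hkj hj
  rcases hkj.eq_or_lt with rfl | hlt
  swap
  · exact ih j hlt hj
  have hg : ∀ j, k < j → j < p.N → p.IsGainForm P Pi (p.gain P) (p.gainBar P Pi) j :=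
    fun j h1 h2 => hs.isGainForm_gain h2 (isUnit_of_sub_smul_one_posSemidef hδ (ih j h1 h2).1)
      (isUnit_of_sub_smul_one_posSemidef hδ (ih j h1 h2).2)
  have key := fun (u : Ω → Fin m → ℝ) hu =>
    coercive_step p hw hδ.le hc hs hk hg (u := u) hu
  obtain ⟨hP, hPi⟩ := hs.transpose (k := k + 1) hk
  rw [posSemidef_iff_forall, posSemidef_iff_forall]
  refine ⟨⟨by simp [p.ups_transpose k hP], fun c => ?_⟩,
    ⟨by simp [p.upsBar_transpose k hP hPi], fun c => ?_⟩⟩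
  -- A centred control `f • c` isolates `Υ_k`. Taking `f` measurable for the initial σ-algebra makes
  -- it available at every time, including `k = 0`, where no noise has been observed.
  · obtain ⟨f, hfm, hf, hf0, hfpos⟩ := exists_centered_scalar h𝓖 hw.le
    have hmeas : Measurable[info 𝓖 w k] fun z => f z • c :=
      (measurable_id.smul_const c).comp (hfm.mono le_sup_left le_rfl)
    have hL2 : MemLp (fun z => f z • c) 2 μ :=
      hf.continuousLinearMap_comp ((1 : ℝ →L[ℝ] ℝ).smulRight c)
    have := key _ ⟨hmeas, hL2⟩
    rw [integral_smul_const, hf0] at this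
    simp only [zero_smul, sub_zero, mulVec_smul, dotProduct_smul, smul_dotProduct, smul_eq_mul,
      mulVec_zero, dotProduct_zero, add_zero, ← mul_assoc, ← sq, integral_mul_const] at this
    rw [mul_comm δ, mul_assoc] at this
    have := le_of_mul_le_mul_left this hfpos
    simpa [sub_mulVec, smul_mulVec] using this
  -- A deterministic control has no fluctuation and isolates `Ῡ_k`.
  · have := key (fun _ => c) ⟨measurable_const, memLp_const _⟩
    simpa [sub_mulVec, smul_mulVec] using this

end Coercive

/-! ### Convexity of the cost and the regularized problem -/

section Convex

variable {n m : ℕ} {Ω : Type*} {𝓖 : MeasurableSpace Ω} {mΩ : MeasurableSpace Ω} {μ : Measure Ω}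
  {w : ℕ → Ω → ℝ}

theorem state_neg (p : MFLQ n m) (u : ℕ → Ω → Fin m → ℝ) (k : ℕ) :
    p.state μ w 0 (fun _ => 0) (-u) k = fun z => -p.state μ w 0 (fun _ => 0) u k z := by
  induction k with
  | zero => simp [state]
  | succ k ih =>
    ext1 z
    simp only [state, ih, step, Nat.not_lt_zero, if_false, Pi.neg_apply, integral_neg, mulVec_neg]
    module

theorem cost_neg (p : MFLQ n m) (u : ℕ → Ω → Fin m → ℝ) :
    p.cost μ w 0 (fun _ => 0) (-u) = p.cost μ w 0 (fun _ => 0) u := by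
  simp [cost, state_neg, integral_neg, mulVec_neg]

theorem state_zero (p : MFLQ n m) (k : ℕ) :
    p.state μ w 0 (fun _ => 0) (0 : ℕ → Ω → Fin m → ℝ) k = fun _ => 0 := by
  induction k with
  | zero => rfl
  | succ k ih =>
    ext1 z
    simp [state, ih, step]

theorem cost_zero (p : MFLQ n m) :
    p.cost μ w 0 (fun _ => 0) (0 : ℕ → Ω → Fin m → ℝ) = 0 := by
  simp [cost, state_zero]

/-- Zero is the midpoint of `u` and `-u`, which have equal cost. -/
theorem cost_nonneg_of_convexOn (p : MFLQ n m)
    (hconv : ConvexOn ℝ (admissible m 𝓖 μ w 0 p.N) (fun u => p.cost μ w 0 (fun _ => 0) u))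
    {u : ℕ → Ω → Fin m → ℝ} (hu : u ∈ admissible m 𝓖 μ w 0 p.N) :
    0 ≤ p.cost μ w 0 (fun _ => 0) u := by
  have hn : -u ∈ admissible m 𝓖 μ w 0 p.N := fun k h1 h2 =>
    ⟨(hu k h1 h2).1.neg, (hu k h1 h2).2.neg⟩
  have := hconv.2 hu hn (by norm_num : (0 : ℝ) ≤ 1 / 2) (by norm_num : (0 : ℝ) ≤ 1 / 2)
    (by norm_num)
  simp only [smul_neg, add_neg_cancel, cost_zero, cost_neg, smul_eq_mul] at this
  linarith

theorem stageCost_reg (p : MFLQ n m) (ε : ℝ) (k : ℕ) {x : Ω → Fin n → ℝ} {u : Ω → Fin m → ℝ}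
    (hx : MemLp x 2 μ) (hu : MemLp u 2 μ) :
    (p.reg ε).stageCost μ k x u = p.stageCost μ k x u + ε * ∫ z, u z ⬝ᵥ u z ∂μ := by
  have h1 := hu.integrable_dotProduct_mulVec hu (p.R k)
  have h2 : Integrable (fun z => u z ⬝ᵥ u z) μ := by
    simpa using hu.integrable_dotProduct_mulVec hu 1
  have e : ∀ z, u z ⬝ᵥ (p.reg ε).R k *ᵥ u z = u z ⬝ᵥ p.R k *ᵥ u z + ε * (u z ⬝ᵥ u z) := fun z => by
    simp [reg, add_mulVec, smul_mulVec]
  rw [stageCost, stageCost, integral_centered_sum _ _ _ hx hu, integral_centered_sum _ _ _ hx hu]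
  simp_rw [e]
  rw [integral_add h1 (h2.const_mul ε), integral_const_mul]
  simp only [reg]
  ring

variable [IsProbabilityMeasure μ]

theorem cost_reg (p : MFLQ n m) (hw : IsNoise 𝓖 μ w p.N) (ε : ℝ) {u : ℕ → Ω → Fin m → ℝ}
    (hu : u ∈ admissible m 𝓖 μ w 0 p.N) :
    (p.reg ε).cost μ w 0 (fun _ => 0) u
      = p.cost μ w 0 (fun _ => 0) u + ε * ∑ k ∈ Finset.Ico 0 p.N, ∫ z, u k z ⬝ᵥ u k z ∂μ := by
  have ht := isTrajectory_state (μ := μ) (w := w) p 0 (fun _ => 0) u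
  -- Regularization changes only `R`, so the dynamics agree by definition.
  have ht' : (p.reg ε).IsTrajectory μ w 0 (p.state μ w 0 (fun _ => 0) u) u := ht
  have h0 : Measurable[info 𝓖 w 0] (fun _ : Ω => (0 : Fin n → ℝ)) ∧
      MemLp (fun _ : Ω => (0 : Fin n → ℝ)) 2 μ := ⟨measurable_const, memLp_const _⟩
  have e1 := ht.cost_eq hw (Nat.zero_le _) h0 hu
  have e2 := ht'.cost_eq (p := p.reg ε) hw (Nat.zero_le _) h0 hu
  have e3 : ∑ k ∈ Finset.Ico 0 p.N, (p.reg ε).stageCost μ k (p.state μ w 0 (fun _ => 0) u k) (u k)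
      = ∑ k ∈ Finset.Ico 0 p.N, (p.stageCost μ k (p.state μ w 0 (fun _ => 0) u k) (u k)
        + ε * ∫ z, u k z ⬝ᵥ u k z ∂μ) := Finset.sum_congr rfl fun k hk =>
    stageCost_reg p ε k
      (ht.adapted hw h0 hu (Nat.zero_le k) (Finset.mem_Ico.1 hk).2.le).2
      (hu k (Nat.zero_le k) (Finset.mem_Ico.1 hk).2).2
  rw [Finset.sum_add_distrib, ← Finset.mul_sum] at e3
  have e2' : (p.reg ε).cost μ w 0 (fun _ => 0) u
      = valueAt μ p.G (p.G + p.Gb) (p.state μ w 0 (fun _ => 0) u p.N)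
        + ∑ k ∈ Finset.Ico 0 p.N,
          (p.reg ε).stageCost μ k (p.state μ w 0 (fun _ => 0) u k) (u k) := e2
  have e1' : p.cost μ w 0 (fun _ => 0) u = _ := e1
  rw [e2', e3, e1']
  ring

theorem exists_isStronglyRegular_reg (p : MFLQ n m) (hw : IsNoise 𝓖 μ w p.N)
    (h𝓖 : NondegenerateInitial 𝓖 μ)
    (hconv : ConvexOn ℝ (admissible m 𝓖 μ w 0 p.N) (fun u => p.cost μ w 0 (fun _ => 0) u))
    {ε : ℝ} (hε : 0 < ε) : ∃ P Pi, (p.reg ε).IsStronglyRegular P Pi := by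
  have hw' : IsNoise 𝓖 μ w (p.reg ε).N := hw
  have hc : ∀ u ∈ admissible m 𝓖 μ w 0 (p.reg ε).N,
      ε * ∑ k ∈ Finset.Ico 0 (p.reg ε).N, ∫ z, u k z ⬝ᵥ u k z ∂μ
        ≤ (p.reg ε).cost μ w 0 (fun _ => 0) u := by
    intro u hu
    rw [cost_reg p hw ε hu]
    exact le_add_of_nonneg_left (cost_nonneg_of_convexOn p hconv hu)
  obtain ⟨P, Pi, hs⟩ := (p.reg ε).exists_isGRESolution
  exact ⟨P, Pi, hs.isStronglyRegular_of_coercive hw' h𝓖 hε hc⟩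

end Convex

end MFLQ

namespace MFLQ

/-! ### Passage to the limit and closed-loop optimality -/

section Limit

open Filter Topology

variable {n m : ℕ}

theorem sq_entry_le_frobSq (M : Matrix (Fin m) (Fin n) ℝ) (i : Fin m) (j : Fin n) :
    M i j ^ 2 ≤ frobSq M := by
  have e : frobSq M = ∑ b, ∑ a, M a b ^ 2 := by
    simp [frobSq, trace, Matrix.mul_apply, sq]
  rw [e]
  have h1 := Finset.single_le_sum (f := fun a => M a j ^ 2) (fun a _ => sq_nonneg _)
    (Finset.mem_univ i)
  have h2 := Finset.single_le_sum (f := fun b => ∑ a, M a b ^ 2)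
    (fun b _ => Finset.sum_nonneg fun a _ => sq_nonneg _) (Finset.mem_univ j)
  exact h1.trans h2

theorem frobSq_nonneg (M : Matrix (Fin m) (Fin n) ℝ) : 0 ≤ frobSq M := by
  simpa [frobSq] using (posSemidef_conjTranspose_mul_self M).trace_nonneg

/-- Sequences of gains on `{0, …, N-1}` with bounded Frobenius norms have convergent
subsequences. -/
theorem exists_tendsto_subseq_of_frobSq_le {N : ℕ} {c : ℝ}
    {Θ : ℕ → ℕ → Matrix (Fin m) (Fin n) ℝ} (h : ∀ j, ∀ k < N, frobSq (Θ j k) ≤ c) :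
    ∃ (L : ℕ → Matrix (Fin m) (Fin n) ℝ) (φ : ℕ → ℕ), StrictMono φ ∧
      ∀ k < N, Tendsto (fun j => Θ (φ j) k) atTop (𝓝 (L k)) := by
  have hb : ∀ j (k : Fin N) a b, |Θ j k a b| ≤ √c := fun j k a b =>
    Real.abs_le_sqrt ((sq_entry_le_frobSq _ a b).trans (h j k k.2))
  -- The finitely many gains are viewed as one point of a compact box in a product of copies of `ℝ`.
  have hK : IsCompact (Set.Icc (fun _ _ _ => -√c : Fin N → Fin m → Fin n → ℝ)
      (fun _ _ _ => √c)) := isCompact_Icc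
  obtain ⟨a, -, φ, hφ, ht⟩ := hK.tendsto_subseq (x := fun j (k : Fin N) i b => Θ j k i b)
    fun j => ⟨fun k i b => (abs_le.1 (hb j k i b)).1, fun k i b => (abs_le.1 (hb j k i b)).2⟩
  refine ⟨fun k => if hk : k < N then of (a ⟨k, hk⟩) else 0, φ, hφ, fun k hk => ?_⟩
  have e : (if hk : k < N then of (a ⟨k, hk⟩) else 0 : Matrix (Fin m) (Fin n) ℝ)
      = of (a ⟨k, hk⟩) := dif_pos hk
  change Tendsto _ _ (𝓝 (if hk : k < N then of (a ⟨k, hk⟩) else 0))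
  rw [e]
  exact tendsto_pi_nhds.1 ht ⟨k, hk⟩

theorem tendsto_matrix_mul {i j k : ℕ} {M : ℕ → Matrix (Fin i) (Fin j) ℝ}
    {M' : ℕ → Matrix (Fin j) (Fin k) ℝ} {L : Matrix (Fin i) (Fin j) ℝ}
    {L' : Matrix (Fin j) (Fin k) ℝ} (h : Tendsto M atTop (𝓝 L)) (h' : Tendsto M' atTop (𝓝 L')) :
    Tendsto (fun a => M a * M' a) atTop (𝓝 (L * L')) :=
  ((continuous_fst.matrix_mul continuous_snd).tendsto (L, L')).comp (h.prodMk_nhds h')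

variable (p : MFLQ n m)

theorem continuous_lyapBar (k : ℕ) :
    Continuous fun q : Matrix (Fin n) (Fin n) ℝ × Matrix (Fin n) (Fin n) ℝ =>
      p.lyapBar k q.1 q.2 := by
  unfold lyapBar; fun_prop

theorem continuous_lyap (k : ℕ) : Continuous (p.lyap k) := by
  unfold lyap; fun_prop

theorem continuous_hh (k : ℕ) : Continuous (p.hh k) := by
  unfold hh; fun_prop

theorem continuous_ups (k : ℕ) : Continuous (p.ups k) := by
  unfold ups; fun_prop

theorem continuous_hhBar (k : ℕ) :
    Continuous fun q : Matrix (Fin n) (Fin n) ℝ × Matrix (Fin n) (Fin n) ℝ =>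
      p.hhBar k q.1 q.2 := by
  unfold hhBar; fun_prop

theorem continuous_upsBar (k : ℕ) :
    Continuous fun q : Matrix (Fin n) (Fin n) ℝ × Matrix (Fin n) (Fin n) ℝ =>
      p.upsBar k q.1 q.2 := by
  unfold upsBar; fun_prop

theorem ups_reg (ε : ℝ) (k : ℕ) (P1 : Matrix (Fin n) (Fin n) ℝ) :
    (p.reg ε).ups k P1 = p.ups k P1 + ε • (1 : Matrix (Fin m) (Fin m) ℝ) := by
  simp only [ups, reg]; abel

theorem upsBar_reg (ε : ℝ) (k : ℕ) (P1 Pi1 : Matrix (Fin n) (Fin n) ℝ) :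
    (p.reg ε).upsBar k P1 Pi1 = p.upsBar k P1 Pi1 + ε • (1 : Matrix (Fin m) (Fin m) ℝ) := by
  simp only [upsBar, reg]; abel

variable {p}

theorem posSemidef_of_tendsto {M : ℕ → Matrix (Fin m) (Fin m) ℝ} {L : Matrix (Fin m) (Fin m) ℝ}
    (h : Tendsto M atTop (𝓝 L)) (hM : ∀ j, (M j).PosSemidef) : L.PosSemidef := by
  simp only [posSemidef_iff_forall] at hM ⊢
  have ht : Continuous fun M : Matrix (Fin m) (Fin m) ℝ => Mᵀ := by fun_prop
  refine ⟨tendsto_nhds_unique ((ht.tendsto L).comp h) (h.congr fun j => (hM j).1.symm),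
    fun c => ?_⟩
  have hc : Continuous fun M : Matrix (Fin m) (Fin m) ℝ => c ⬝ᵥ M *ᵥ c := by fun_prop
  exact ge_of_tendsto' ((hc.tendsto L).comp h) fun j => (hM j).2 c

/-- Riccati solutions of regularized problems converge along convergent gains. -/
theorem exists_isGainForm_of_tendsto {ε : ℕ → ℝ} (hε : Tendsto ε atTop (𝓝 0))
    {P Pi : ℕ → ℕ → Matrix (Fin n) (Fin n) ℝ} {Θ Θb : ℕ → ℕ → Matrix (Fin m) (Fin n) ℝ}
    (hP : ∀ j, P j p.N = p.G) (hPi : ∀ j, Pi j p.N = p.G + p.Gb)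
    (hg : ∀ j, ∀ k < p.N, (p.reg (ε j)).IsGainForm (P j) (Pi j) (Θ j) (Θb j) k)
    (hY : ∀ j, ∀ k < p.N, ((p.reg (ε j)).ups k (P j (k + 1))).PosSemidef ∧
      ((p.reg (ε j)).upsBar k (P j (k + 1)) (Pi j (k + 1))).PosSemidef)
    {L Lb : ℕ → Matrix (Fin m) (Fin n) ℝ}
    (hL : ∀ k < p.N, Tendsto (fun j => Θ j k) atTop (𝓝 (L k)))
    (hLb : ∀ k < p.N, Tendsto (fun j => Θb j k) atTop (𝓝 (Lb k))) :
    ∃ P' Pi' : ℕ → Matrix (Fin n) (Fin n) ℝ, P' p.N = p.G ∧ Pi' p.N = p.G + p.Gb ∧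
      ∀ k < p.N, p.IsGainForm P' Pi' L Lb k ∧ (p.ups k (P' (k + 1))).PosSemidef ∧
        (p.upsBar k (P' (k + 1)) (Pi' (k + 1))).PosSemidef := by
  have htr : Continuous fun M : Matrix (Fin m) (Fin n) ℝ => Mᵀ := by fun_prop
  -- The matrices `lyap`, `hh` and their barred versions do not involve `R`, so `ε` is absent and
  -- continuity alone gives the limit.
  have limP : ∀ {k A B}, k < p.N →
      Tendsto (fun j => (P j (k + 1), Pi j (k + 1))) atTop (𝓝 (A, B)) →
      Tendsto (fun j => P j k) atTop (𝓝 (p.lyap k A + (p.hh k A)ᵀ * L k)) ∧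
      Tendsto (fun j => Pi j k) atTop (𝓝 (p.lyapBar k A B + (p.hhBar k A B)ᵀ * Lb k)) := by
    intro k A B hk h
    have hA : Tendsto (fun j => P j (k + 1)) atTop (𝓝 A) :=
      (continuous_fst.tendsto _).comp h
    have t1 := ((p.continuous_lyap k).tendsto A).comp hA
    have t2 := ((htr.comp (p.continuous_hh k)).tendsto A).comp hA
    have t3 := ((p.continuous_lyapBar k).tendsto (A, B)).comp h
    have t4 := ((htr.comp (p.continuous_hhBar k)).tendsto (A, B)).comp h
    exact ⟨(t1.add (tendsto_matrix_mul t2 (hL k hk))).congr fun j => ((hg j k hk).eq).symm,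
      (t3.add (tendsto_matrix_mul t4 (hLb k hk))).congr fun j => ((hg j k hk).eqBar).symm⟩
  -- The bound `k ≤ p.N` sits inside the existential so that `choose` yields limits indexed by all
  -- of `ℕ`.
  have hex : ∀ k, ∃ q : Matrix (Fin n) (Fin n) ℝ × Matrix (Fin n) (Fin n) ℝ, k ≤ p.N →
      Tendsto (fun j => (P j k, Pi j k)) atTop (𝓝 q) := by
    intro k
    by_cases hk : k ≤ p.N
    swap
    · exact ⟨0, fun h => absurd h hk⟩
    refine backward_induction (motive := fun k => ∃ q : Matrix (Fin n) (Fin n) ℝ ×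
      Matrix (Fin n) (Fin n) ℝ, k ≤ p.N → Tendsto (fun j => (P j k, Pi j k)) atTop (𝓝 q)) ?_ ?_ hk
    · exact ⟨(p.G, p.G + p.Gb), fun _ => by simp [hP, hPi]⟩
    · rintro k hk ⟨⟨A, B⟩, hq⟩
      obtain ⟨h1, h2⟩ := limP hk (hq hk)
      exact ⟨_, fun _ => h1.prodMk_nhds h2⟩
  choose q hq using hex
  have h1 : ∀ k ≤ p.N, Tendsto (fun j => P j k) atTop (𝓝 (q k).1) := fun k hk =>
    (continuous_fst.tendsto _).comp (hq k hk)
  have h2 : ∀ k ≤ p.N, Tendsto (fun j => Pi j k) atTop (𝓝 (q k).2) := fun k hk =>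
    (continuous_snd.tendsto _).comp (hq k hk)
  refine ⟨fun k => (q k).1, fun k => (q k).2,
    tendsto_nhds_unique (h1 _ le_rfl) (by simp [hP]),
    tendsto_nhds_unique (h2 _ le_rfl) (by simp [hPi]), fun k hk => ?_⟩
  have hA := h1 (k + 1) hk
  have hB := h2 (k + 1) hk
  have hAB := hq (k + 1) hk
  have tI : Tendsto (fun j => ε j • (1 : Matrix (Fin m) (Fin m) ℝ)) atTop (𝓝 0) := by
    simpa using hε.smul_const (1 : Matrix (Fin m) (Fin m) ℝ)
  have tY : Tendsto (fun j => (p.reg (ε j)).ups k (P j (k + 1))) atTop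
      (𝓝 (p.ups k (q (k + 1)).1)) := by
    simp_rw [ups_reg]
    simpa using (((p.continuous_ups k).tendsto _).comp hA).add tI
  have tYb : Tendsto (fun j => (p.reg (ε j)).upsBar k (P j (k + 1)) (Pi j (k + 1))) atTop
      (𝓝 (p.upsBar k (q (k + 1)).1 (q (k + 1)).2)) := by
    simp_rw [upsBar_reg]
    simpa using (((p.continuous_upsBar k).tendsto _).comp hAB).add tI
  have htn : Continuous fun M : Matrix (Fin n) (Fin n) ℝ => Mᵀ := by fun_prop
  refine ⟨⟨?_, ?_, ?_, ?_, ?_, ?_⟩, posSemidef_of_tendsto tY fun j => (hY j k hk).1,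
    posSemidef_of_tendsto tYb fun j => (hY j k hk).2⟩
  · exact tendsto_nhds_unique ((htn.tendsto _).comp hA) (hA.congr fun j => (hg j k hk).symm.symm)
  · exact tendsto_nhds_unique ((htn.tendsto _).comp hB)
      (hB.congr fun j => (hg j k hk).symmBar.symm)
  · exact tendsto_nhds_unique (tendsto_matrix_mul tY (hL k hk))
      ((((p.continuous_hh k).tendsto _).comp hA).neg.congr fun j => (hg j k hk).gain.symm)
  · exact tendsto_nhds_unique (tendsto_matrix_mul tYb (hLb k hk))
      ((((p.continuous_hhBar k).tendsto _).comp hAB).neg.congr fun j => (hg j k hk).gainBar.symm)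
  · exact tendsto_nhds_unique (h1 k hk.le) (limP hk hAB).1
  · exact tendsto_nhds_unique (h2 k hk.le) (limP hk hAB).2

/-- If all regularized problems have strongly regular Riccati solutions, with bounded gains, then
the Riccati equation has a regular solution in gain form. -/
theorem RegularizedGainsBounded.exists_isGainForm (hgain : p.RegularizedGainsBounded)
    (hex : ∀ ε : ℝ, 0 < ε → ∃ P Pi, (p.reg ε).IsStronglyRegular P Pi) :
    ∃ (P Pi : ℕ → Matrix (Fin n) (Fin n) ℝ) (Θ Θb : ℕ → Matrix (Fin m) (Fin n) ℝ),
      P p.N = p.G ∧ Pi p.N = p.G + p.Gb ∧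
      ∀ k < p.N, p.IsGainForm P Pi Θ Θb k ∧ (p.ups k (P (k + 1))).PosSemidef ∧
        (p.upsBar k (P (k + 1)) (Pi (k + 1))).PosSemidef := by
  obtain ⟨c, hc⟩ := hgain
  set ε : ℕ → ℝ := fun j => 1 / ((j : ℝ) + 1) with hεdef
  have hε : ∀ j, 0 < ε j := fun j => Nat.one_div_pos_of_nat
  choose P Pi hs using fun j => hex (ε j) (hε j)
  have hb := fun j => hc (ε j) (hε j) _ _ (hs j)
  have hb' : ∀ j, ∀ k < p.N, frobSq ((p.reg (ε j)).gain (P j) k)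
      + frobSq ((p.reg (ε j)).gainBar (P j) (Pi j) k) ≤ c := fun j k hk =>
    (Finset.single_le_sum (f := fun k => frobSq ((p.reg (ε j)).gain (P j) k)
      + frobSq ((p.reg (ε j)).gainBar (P j) (Pi j) k))
      (fun k _ => add_nonneg (frobSq_nonneg _) (frobSq_nonneg _))
      (Finset.mem_range.2 hk)).trans (hb j)
  obtain ⟨L, φ, hφ, hL⟩ := exists_tendsto_subseq_of_frobSq_le
    (Θ := fun j => (p.reg (ε j)).gain (P j)) (c := c) (N := p.N)
    fun j k hk => (le_add_of_nonneg_right (frobSq_nonneg _)).trans (hb' j k hk)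
  -- A further subsequence of the one already chosen for `Θ`, so both families converge along `φ ∘
  -- ψ`.
  obtain ⟨Lb, ψ, hψ, hLb⟩ := exists_tendsto_subseq_of_frobSq_le
    (Θ := fun j => (p.reg (ε (φ j))).gainBar (P (φ j)) (Pi (φ j))) (c := c) (N := p.N)
    fun j k hk => (le_add_of_nonneg_left (frobSq_nonneg _)).trans (hb' (φ j) k hk)
  have hε0 : Tendsto (fun j => ε (φ (ψ j))) atTop (𝓝 0) :=
    tendsto_one_div_add_atTop_nhds_zero_nat.comp (hφ.comp hψ).tendsto_atTop
  obtain ⟨P', Pi', h⟩ := exists_isGainForm_of_tendsto (p := p) hε0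
    (P := fun j => P (φ (ψ j))) (Pi := fun j => Pi (φ (ψ j)))
    (fun j => (hs _).1.1) (fun j => (hs _).1.2.1)
    (fun j k hk => by
      obtain ⟨hG, α, hα, hr⟩ := hs (φ (ψ j))
      exact hG.isGainForm_gain hk (isUnit_of_sub_smul_one_posSemidef hα (hr k hk).1)
        (isUnit_of_sub_smul_one_posSemidef hα (hr k hk).2))
    (fun j k hk => by
      obtain ⟨hG, α, hα, hr⟩ := hs (φ (ψ j))
      have h1 : (α • (1 : Matrix (Fin m) (Fin m) ℝ)).PosSemidef := PosSemidef.one.smul hα.le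
      exact ⟨by simpa using (hr k hk).1.add h1, by simpa using (hr k hk).2.add h1⟩)
    (fun k hk => (hL k hk).comp hψ.tendsto_atTop) hLb
  exact ⟨P', Pi', L, Lb, h⟩

end Limit

/-! ### Regularity of the limit and verification of optimality -/

section ClosedLoop

variable {n m : ℕ} {p : MFLQ n m} {P Pi : ℕ → Matrix (Fin n) (Fin n) ℝ}
  {Θ Θb : ℕ → Matrix (Fin m) (Fin n) ℝ}

theorem isRegular_of_isGainForm (hN : P p.N = p.G) (hNb : Pi p.N = p.G + p.Gb)
    (h : ∀ k < p.N, p.IsGainForm P Pi Θ Θb k ∧ (p.ups k (P (k + 1))).PosSemidef ∧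
      (p.upsBar k (P (k + 1)) (Pi (k + 1))).PosSemidef) : p.IsRegular P Pi :=
  ⟨isGRESolution_of_isGainForm hN hNb fun k hk => (h k hk).1, fun k hk =>
    ⟨(h k hk).2.1, (h k hk).2.2, range_mulVecLin_le_of_mul_eq_neg (h k hk).1.gain,
      range_mulVecLin_le_of_mul_eq_neg (h k hk).1.gainBar⟩⟩

variable {Ω : Type*} {𝓖 : MeasurableSpace Ω} {mΩ : MeasurableSpace Ω} {μ : Measure Ω}
  [IsProbabilityMeasure μ] {w : ℕ → Ω → ℝ}

/-- Every admissible control costs the value of `ξ` plus nonnegative penalties, and the feedback has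
none. The problem is homogeneous, so `v = 0` suffices. -/
theorem isClosedLoopOptimal_of_isGainForm (hw : IsNoise 𝓖 μ w p.N) (hN : P p.N = p.G)
    (hNb : Pi p.N = p.G + p.Gb)
    (h : ∀ k < p.N, p.IsGainForm P Pi Θ Θb k ∧ (p.ups k (P (k + 1))).PosSemidef ∧
      (p.upsBar k (P (k + 1)) (Pi (k + 1))).PosSemidef) {l : ℕ} (hl : l < p.N) :
    p.IsClosedLoopOptimal 𝓖 μ w l Θ (fun k => Θb k - Θ k) (fun _ => 0) := by
  intro ξ hξm hξ u'
  have hxa : ∀ k, l ≤ k → k ≤ p.N → _ := fun k h1 h2 =>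
    closedLoopState_adapted p hw ⟨hξm, hξ⟩ Θ (fun k => Θb k - Θ k) (fun _ => 0) h1 h2
  have hu' : u' ∈ admissible m 𝓖 μ w l p.N := fun k h1 h2 =>
    feedback_adapted (hxa k h1 h2.le) _ _ _
  have hcost : ∀ {x : ℕ → Ω → Fin n → ℝ} {u}, x l = ξ → p.IsTrajectory μ w l x u →
      u ∈ admissible m 𝓖 μ w l p.N →
      p.cost μ w l ξ u = valueAt μ (P l) (Pi l) ξ + ∑ k ∈ Finset.Ico l p.N,
        penalty μ (p.ups k (P (k + 1))) (p.upsBar k (P (k + 1)) (Pi (k + 1))) (Θ k) (Θb k)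
          (x k) (u k) := by
    intro x u hx ht hu
    have ha : Measurable[info 𝓖 w l] (x l) ∧ MemLp (x l) 2 μ := by rw [hx]; exact ⟨hξm, hξ⟩
    rw [← hx, ht.cost_eq hw hl.le ha hu, ← hNb, ← hN,
      ht.valueAt_add_sum hw hl.le ha hu fun k _ hk => (h k hk).1]
  refine ⟨hu', fun u hu => ?_⟩
  rw [hcost (closedLoopState_self p l ξ Θ _ _) (isTrajectory_closedLoopState p l ξ Θ _ _) hu',
    hcost (state_self p l ξ u) (isTrajectory_state p l ξ u) hu, Finset.sum_eq_zero]
  · gcongr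
    exact Finset.sum_nonneg fun k hk =>
      penalty_nonneg (h k (Finset.mem_Ico.1 hk).2).2.1 (h k (Finset.mem_Ico.1 hk).2).2.2 _ _ _ _
  · intro k hk
    rw [Finset.mem_Ico] at hk
    exact penalty_feedback (hxa k hk.1 hk.2.le).2

end ClosedLoop

end MFLQ

theorem theorem6p4 {n m : ℕ} {Ω : Type*} (𝓖 : MeasurableSpace Ω) [MeasurableSpace Ω]
    (μ : Measure Ω) [IsProbabilityMeasure μ] (w : ℕ → Ω → ℝ) (p : MFLQ n m)
    (hw : IsNoise 𝓖 μ w p.N) (h𝓖 : NondegenerateInitial 𝓖 μ)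
    (hconv : ConvexOn ℝ (MFLQ.admissible m 𝓖 μ w 0 p.N) (fun u => p.cost μ w 0 (fun _ => 0) u))
    (hgain : p.RegularizedGainsBounded) :
    p.RegularlySolvable ∧ p.ClosedLoopSolvable 𝓖 μ w := by
  obtain ⟨P, Pi, Θ, Θb, hN, hNb, h⟩ := hgain.exists_isGainForm fun ε hε =>
    p.exists_isStronglyRegular_reg hw h𝓖 hconv hε
  exact ⟨⟨P, Pi, MFLQ.isRegular_of_isGainForm hN hNb h⟩, Θ, fun k => Θb k - Θ k, fun _ => 0,
    fun l hl => MFLQ.isClosedLoopOptimal_of_isGainForm hw hN hNb h hl⟩
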